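/- **Setting.** Let $G_0,G_1,G_2,\dots$ be weighted undirected graphs on a finite vertex set $V$ (no self-loops, all edge weights at least $1$), where $G_{t+1}$ arises from $G_t$ by deleting edges and/or increasing edge weights. Write $d_{t,G}$ for the shortest path distance of $G_t$ ($\infty$ if there is no path), $d^{(h)}_{X}$ for the minimum weight of a path with at most $h$ edges in a graph $X$, and, for graphs on $V$, let $X\cup Y$ be their union (the lighter of two parallel edges counts). A graph $H$ on $V$ is a $(\beta,1+\epsilon)$-hopset of $X$ if $d_X(u,v)\le d^{(\beta)}_{X\cup H}(u,v)\le(1+\epsilon)\,d_X(u,v)$ for all $u,v\in V$. Let $V=A_0\supseteq A_1\supseteq\cdots\supseteq A_K=\emptyset$ be arbitrary fixed sets (the sampled sets, $K=k+1/\rho+1$ levels). Let $0<\epsilon<1$, $W\ge 2$, $0<\epsilon'\le \frac{\epsilon}{6\log_2 W}$, $\delta=\frac{\epsilon'}{8K}$, $\beta=\lceil(3/\delta)^{K}\rceil$, $\ell=2\beta+1$, $\eta_j=\epsilon' 2^j/\ell$, $D=\lceil 2\ell/\epsilon'\rceil$, and let $\kappa\in[0,1]$ be the parameter of the approximate clusters.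 **The maintained graphs.** Put $H_0=\emptyset$ and $\bar H_j=H_0\cup\dots\cup H_j$. For $j\ge 0$ the scaled graph $G^j$ is $G\cup\bar H_j$ (at every time $t$) with each weight $w(e)$ replaced by $\hat w(e)=\lceil w(e)/\eta_j\rceil$. For a root set $S\subseteq V$, the monotone Even–Shiloach tree on $G^j$ with root set $S$ keeps levels $L_{t,j}(S,\cdot)$: $L_{t,j}(S,v)=0$ for $v\in S$, and, starting from the levels at time $t-1$ (from $0$ at initialization), the level of each $v\notin S$ is raised to $\min_x \big(L(S,x)+\hat w_t(x,v)\big)$ whenever it is smaller than that, until this is no longer possible; levels never decrease, and a level exceeding $D$ is set to $\infty$. Write $L_{t,j}(z,\cdot)$ for $S=\{z\}$. For $z\in A_i\setminus A_{i+1}$ the cluster of $z$ on $G^j$ at time $t$ is $C(z)=\{v: (1+\kappa)L_{t,j}(z,v)<L_{t,j}(A_{i+1},v)\}$, and, if $L_{t,j}(A_{i+1},z)<\infty$, the pivot $p(z)\in A_{i+1}$ is the root reached from $z$ in the tree with root set $A_{i+1}$ by repeatedly moving from a vertex $v\notin A_{i+1}$ to a vertex $x$ minimizing $L(A_{i+1},x)+\hat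 w_t(x,v)$ (ties broken arbitrarily). At time $t$ the graph $H_{j+1}$ consists of the edges $\{z,v\}$, $v\in C(z)$, $v\neq z$, with weight $\min_{0\le r\le j}\eta_r L_{t,r}(z,v)$, and the edges $\{z,p(z)\}$ with weight $\eta_jL_{t,j}(A_{i+1},z)$. **Claim.** For every choice of the sets $A_i$, of $\kappa$ and of the tie-breaking: 1. After every update $t$, for every integer $0\le j\le\log_2 W$ and every pair $x,y\in V$ with $2^j\le d_{t,G}(x,y)\le 2^{j+1}$, $$d_{t,G}(x,y)\le d_{t,G\cup\bar H_j}(x,y)\le d^{(\beta)}_{t,G\cup\bar H_j}(x,y)\le(1+3\epsilon')^j\,d_{t,G}(x,y).$$ 2. Consequently, if all finite distances of $G_t$ are at most $W$, then at time $t$ the graph $\bar H_J$ is a $(\beta,1+\epsilon)$-hopset of $G_t$ for every $J\ge\lfloor\log_2W\rfloor$. -/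

import Mathlib

open scoped ENNReal

noncomputable section

namespace DecHopset

/-! ### Weighted undirected graphs and (hop-limited) distances -/

/-- A weighted undirected graph on the vertex set `V` without self-loops.
`wt u v` is the weight of the edge `{u, v}`, and `wt u v = ⊤` says that there is no such edge. -/
@[ext]
structure WGraph (V : Type*) where
  wt : V → V → ℝ≥0∞
  symm : ∀ u v, wt u v = wt v u
  loopless : ∀ v, wt v v = ⊤

variable {V : Type*}

/-- The graph without edges. -/
def WGraph.empty (V : Type*) : WGraph V where
  wt _ _ := ⊤
  symm _ _ := rfl
  loopless _ := rfl

/-- The union of two weighted graphs; of two parallel edges the lighter one counts. -/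
def WGraph.union (G H : WGraph V) : WGraph V where
  wt u v := min (G.wt u v) (H.wt u v)
  symm u v := by rw [G.symm, H.symm]
  loopless v := by rw [G.loopless, H.loopless, min_self]

/-- The weight of the walk that starts in `u` and then visits the vertices of the list in order;
it is `⊤` if a step of the walk is not an edge. -/
def WGraph.walkWeight (G : WGraph V) : V → List V → ℝ≥0∞
  | _, [] => 0
  | u, x :: p => G.wt u x + G.walkWeight x p

/-- The shortest path distance `d_G(u, v)`. -/
def WGraph.dist (G : WGraph V) (u v : V) : ℝ≥0∞ :=
  ⨅ (p : List V) (_ : p.getLastD u = v), G.walkWeight u p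

/-- The `h`-hop limited distance `d_G^{(h)}(u, v)`. -/
def WGraph.hopDist (G : WGraph V) (h : ℕ) (u v : V) : ℝ≥0∞ :=
  ⨅ (p : List V) (_ : p.getLastD u = v) (_ : p.length ≤ h), G.walkWeight u p

/-- `H` is a `(d, β, 1 + ε)`-hopset of `G`; `d = ⊤` gives the `(β, 1 + ε)`-hopsets. -/
def IsHopset (G H : WGraph V) (d : ℝ≥0∞) (β : ℕ) (ε : ℝ) : Prop :=
  ∀ u v, G.dist u v ≤ d →
    G.dist u v ≤ (G.union H).hopDist β u v ∧
      (G.union H).hopDist β u v ≤ ENNReal.ofReal (1 + ε) * G.dist u v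

/-! ### Scaling -/

/-- The rounding unit `η(R, ε₀) = ε₀ R / ℓ`. -/
def unit (R ε₀ : ℝ) (l : ℕ) : ℝ := ε₀ * R / l

/-- The weights `⌈w(e) / η(R, ε₀)⌉` of the scaled graph `Scale(G, R, ε₀, ℓ)`. -/
def scale (G : WGraph V) (R ε₀ : ℝ) (l : ℕ) : V → V → ℕ∞ :=
  fun u v => ENat.ceil (G.wt u v / ENNReal.ofReal (unit R ε₀ l))

/-! ### Monotone Even–Shiloach trees -/

/-- Levels are maintained up to depth `D`; larger levels are recorded as `⊤`. -/
def cap (D : ℕ) (a : ℕ∞) : ℕ∞ := if a ≤ D then a else ⊤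

theorem cap_mono (D : ℕ) : Monotone (cap D) := by
  intro a b h
  unfold cap
  by_cases hb : b ≤ D
  · simp [hb, h.trans hb, h]
  · simp [hb]

/-- One round of the update rule of a monotone ES tree for the weights `w`, the set of roots `S`
and the depth `D`: the level of a root is `0`, and the level of any other vertex `v` is raised to
`min_x (L x + w x v)` when it is smaller than that, and never drops below `prev v`. -/
def esRound (w : V → V → ℕ∞) (S : Set V) (D : ℕ) (prev : V → ℕ∞) :
    (V → ℕ∞) →o (V → ℕ∞) where
  toFun L v := by
    classical
    exact if v ∈ S then 0 else cap D (max (prev v) (⨅ x, (L x + w x v)))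
  monotone' := by
    intro L L' h v
    dsimp only
    split_ifs
    · exact le_rfl
    · exact cap_mono D (max_le_max le_rfl (iInf_mono fun x => add_le_add (h x) le_rfl))

/-- The levels that the monotone ES tree reaches from the levels `prev`: levels are raised, starting
from `prev`, until no vertex violates the update rule. The result is the least
such level function. -/
def esUpdate (w : V → V → ℕ∞) (S : Set V) (D : ℕ) (prev : V → ℕ∞) : V → ℕ∞ :=
  (esRound w S D prev).lfp

/-- The levels `L_t(S, ·)` of a monotone ES tree up to depth `D` with set of roots `S` (a set of
several roots stands for a dummy root attached to all of them) on the graph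
whose weights at time `t` are `w t`. The initialization starts from the levels `0`. -/
def esLevel (w : ℕ → V → V → ℕ∞) (D : ℕ) (S : Set V) : ℕ → V → ℕ∞
  | 0 => esUpdate (w 0) S D fun _ => 0
  | t + 1 => esUpdate (w (t + 1)) S D (esLevel w D S t)

/-- `IsRootOf w S L v a`: following parents from `v` in a tree with levels `L` can lead to the root
`a`, where a parent of a non-root `v` is a vertex `x` that minimizes `L x + w x v`. -/
inductive IsRootOf (w : V → V → ℕ∞) (S : Set V) (L : V → ℕ∞) : V → V → Prop
  | root (a : V) (ha : a ∈ S) : IsRootOf w S L a a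
  | step (v x a : V) (hv : v ∉ S) (hmin : ∀ y, L x + w x v ≤ L y + w y v)
      (hx : IsRootOf w S L x a) : IsRootOf w S L v a

/-! ### The decremental hopset -/

/-- The input of the hopset algorithm besides the graph:
the sampled sets `V = A 0 ⊇ A 1 ⊇ …`, the parameter `κ` of the approximate clusters, the rounding
parameter `ε₂`, the hopbound `β`, and a tie-breaking rule for the pivots
(`pick t j u S` is the vertex that is chosen at time `t` and scale `j` for `u` among those of `S`). -/
structure Config (V : Type*) where
  A : ℕ → Set V
  κ : ℝ
  ε₂ : ℝ
  β : ℕ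
  pick : ℕ → ℕ → V → Set V → V

namespace Config

variable (c : Config V)

/-- The rounding unit `η(2^j, ε₂)` of scale `j`, where `ℓ = 2β + 1`. -/
def eta (j : ℕ) : ℝ := unit (2 ^ j) c.ε₂ (2 * c.β + 1)

/-- The depth `⌈2(2β + 1) / ε₂⌉` of all trees. -/
def depth : ℕ := ⌈2 * (2 * (c.β : ℝ) + 1) / c.ε₂⌉₊

/-- The weights at time `t` of the scaled graph `G^j = Scale(X, 2^j, ε₂, 2β + 1)`, where `X t` is
the graph `G ∪ H_0 ∪ … ∪ H_j` at time `t`. -/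
def scaled (j : ℕ) (X : ℕ → WGraph V) (t : ℕ) : V → V → ℕ∞ :=
  scale (X t) (2 ^ j) c.ε₂ (2 * c.β + 1)

/-- The levels `L_{t,j}(S, v)` in the monotone ES tree with root set `S` on `G^j`. -/
def level (j : ℕ) (X : ℕ → WGraph V) (t : ℕ) (S : Set V) (v : V) : ℕ∞ :=
  esLevel (c.scaled j X) c.depth S t v

/-- `v` belongs at time `t` to the approximate cluster `C(z)` on `G^j`:
`L(z, v) < L(v, A_{i+1}) / (1 + κ)`, where `z ∈ A_i \ A_{i+1}`. -/
def InCluster (j : ℕ) (X : ℕ → WGraph V) (t : ℕ) (z v : V) : Prop :=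
  ∃ i, z ∈ c.A i ∧ z ∉ c.A (i + 1) ∧
    ENNReal.ofReal (1 + c.κ) * (c.level j X t {z} v : ℝ≥0∞) <
      (c.level j X t (c.A (i + 1)) v : ℝ≥0∞)

/-- The pivot `p(u) ∈ A_{i+1}` of `u ∈ A_i \ A_{i+1}`: the root of `u` in the
monotone ES tree of `A_{i+1}` on `G^j`. -/
def pivot (j : ℕ) (X : ℕ → WGraph V) (t i : ℕ) (u : V) : V :=
  c.pick t j u {a | IsRootOf (c.scaled j X t) (c.A (i + 1)) (c.level j X t (c.A (i + 1))) u a}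

/-- The weight of the hopset edge from a cluster center `z` to a vertex `v` of its cluster (`est`)
or from a vertex `z` to its pivot `v` (the unscaled level of `z`); it is `⊤` if there is no
such edge. -/
def hopEdge (j : ℕ) (X : ℕ → WGraph V) (est : V → V → ℝ≥0∞) (t : ℕ) (z v : V) : ℝ≥0∞ :=
  min (⨅ _ : c.InCluster j X t z v, est z v)
    (⨅ (i : ℕ) (_ : z ∈ c.A i ∧ z ∉ c.A (i + 1) ∧ v = c.pivot j X t i z),
      ENNReal.ofReal (c.eta j) * (c.level j X t (c.A (i + 1)) z : ℝ≥0∞))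

/-- The hopset edges `H_{j+1}` at time `t`, obtained by unscaling the restricted hopset on `G^j`. -/
def newEdges (j : ℕ) (X : ℕ → WGraph V) (est : V → V → ℝ≥0∞) (t : ℕ) : WGraph V where
  wt u v := ⨅ _ : u ≠ v, min (c.hopEdge j X est t u v) (c.hopEdge j X est t v u)
  symm u v := by
    simp only [ne_comm (a := u) (b := v), min_comm (c.hopEdge j X est t u v)]
  loopless v := by simp

/-- The state of the algorithm for the dynamic graph `G`: for every `j`, the graph
`H̄_j = H_0 ∪ … ∪ H_j` over time, with `H_0 = ∅`, and the distance estimates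
`min_{r < j} η(2^r, ε₂) L_{t,r}(z, v)` over time, taken from the trees rooted at `z`. -/
def run (G : ℕ → WGraph V) : ℕ → (ℕ → WGraph V) × (ℕ → V → V → ℝ≥0∞)
  | 0 => (fun _ => WGraph.empty V, fun _ _ _ => ⊤)
  | j + 1 =>
    let X : ℕ → WGraph V := fun t => (G t).union ((run G j).1 t)
    let est : ℕ → V → V → ℝ≥0∞ := fun t z v =>
      min ((run G j).2 t z v) (ENNReal.ofReal (c.eta j) * (c.level j X t {z} v : ℝ≥0∞))
    (fun t => ((run G j).1 t).union (c.newEdges j X (est t) t), est)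

/-- The maintained graph `H̄_j = H_0 ∪ … ∪ H_j` after `t` updates. -/
def Hbar (G : ℕ → WGraph V) (j t : ℕ) : WGraph V := (c.run G j).1 t

end Config

end DecHopset

end

namespace DecHopset

variable {V : Type*}

/-! ### Walks and distances -/

/-! Lower bounds: following parents in a tree never costs more than the unscaled level of the
starting vertex. By induction on the scale, no hopset edge is shorter than the distance of its ends
(`dist_le_Hbar_and_estimate`).

Upper bounds: one potential argument, `bound_of_jumps`, serves twice. Each edge used is charged `η`
on top of its weight. To follow a walk, a vertex of rank `i` either takes a hopset edge to the last
vertex within `D i` and then the next edge of `G`, or moves to a pivot of higher rank. The first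
move is paid for by the stretch gap `α - σ` on a piece longer than `D i`, the second by the drop
from `γ i` to `γ (i + 1)`. `exists_jump` supplies these moves from levels of smaller scales, and
`exists_offsets` the numbers.

If cost means unscaled level and `η` is the rounding unit, this yields `level_le`, where each scale
adds `ε'` to the stretch. If cost means weight plus `η` per hop, it yields `exists_reach_augmented`.
The weight is at least the distance, so the small excess cost bounds the number of hops.

Hopset edges may appear or become lighter, so a monotone level can exceed what its neighbours
suggest (a stretched edge). Such a vertex kept its old level, and the old bound `α * P + γ i` still
applies: it does not mention time, ranks are fixed, and a walk in the present `G` was no heavier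
before. Edges of `G` itself are never stretched. -/

/-- There is a walk in `G` from the first to the second vertex with the given number of edges and
with weight at most the given real number. -/
inductive WGraph.Reach (G : WGraph V) : V → V → ℕ → ℝ → Prop
  | nil (v : V) {P : ℝ} (hP : 0 ≤ P) : WGraph.Reach G v v 0 P
  | cons {v x u : V} {n : ℕ} {w P : ℝ} (hw : 0 ≤ w) (hwt : G.wt v x ≤ ENNReal.ofReal w)
      (h : WGraph.Reach G x u n P) : WGraph.Reach G v u (n + 1) (w + P)

namespace WGraph

variable {G H X : WGraph V}

theorem Reach.nonneg {v u : V} {n : ℕ} {P : ℝ} (h : G.Reach v u n P) : 0 ≤ P := by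
  induction h with
  | nil v hP => exact hP
  | cons hw _ _ ih => exact add_nonneg hw ih

theorem Reach.mono {v u : V} {n : ℕ} {P Q : ℝ} (h : G.Reach v u n P) (hPQ : P ≤ Q) :
    G.Reach v u n Q := by
  induction h generalizing Q with
  | nil v hP => exact .nil v (hP.trans hPQ)
  | @cons v x u n w P hw hwt h ih =>
    have := Reach.cons hw hwt (ih (Q := Q - w) (by linarith))
    simpa using this

theorem Reach.of_graph_le {v u : V} {n : ℕ} {P : ℝ} (h : G.Reach v u n P)
    (hH : ∀ a b, H.wt a b ≤ G.wt a b) : H.Reach v u n P := by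
  induction h with
  | nil v hP => exact .nil v hP
  | cons hw hwt _ ih => exact .cons hw ((hH _ _).trans hwt) ih

theorem Reach.of_edge {v u : V} {w : ℝ} (hw : 0 ≤ w) (h : G.wt v u ≤ ENNReal.ofReal w) :
    G.Reach v u 1 w := by
  simpa using Reach.cons hw h (.nil u le_rfl)

theorem Reach.trans {v u x : V} {n m : ℕ} {P Q : ℝ} (h : G.Reach v u n P)
    (h' : G.Reach u x m Q) : G.Reach v x (n + m) (P + Q) := by
  induction h with
  | nil v hP => simpa using h'.mono (le_add_of_nonneg_left hP)
  | cons hw hwt _ ih =>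
    rw [add_assoc (_ : ℝ), Nat.add_right_comm]
    exact .cons hw hwt (ih h')

theorem Reach.symm {v u : V} {n : ℕ} {P : ℝ} (h : G.Reach v u n P) : G.Reach u v n P := by
  induction h with
  | nil v hP => exact .nil v hP
  | @cons v x u n w P hw hwt _ ih =>
    rw [add_comm w P]
    exact ih.trans (.of_edge hw (by rwa [G.symm]))

/-- In a graph with weights at least `1`, a walk with `n` edges has weight at least `n`. -/
theorem Reach.length_le (hG : ∀ a b, 1 ≤ G.wt a b) {v u : V} {n : ℕ} {P : ℝ}
    (h : G.Reach v u n P) : (n : ℝ) ≤ P := by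
  induction h with
  | nil v hP => simpa using hP
  | @cons v x u n w P hw hwt _ ih =>
    have : 1 ≤ w := by simpa using (hG v x).trans hwt
    push_cast
    linarith

theorem Reach.one_le (hG : ∀ a b, 1 ≤ G.wt a b) {v u : V} {n : ℕ} {P : ℝ}
    (h : G.Reach v u n P) (hne : v ≠ u) : 1 ≤ P := by
  have h1 := h.length_le hG
  have : n ≠ 0 := by
    rintro rfl
    cases h
    exact hne rfl
  have : (1 : ℝ) ≤ n := by exact_mod_cast Nat.one_le_iff_ne_zero.2 this
  linarith

/-- A walk is cut behind the last vertex up to which its weight is at most `D`. -/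
theorem Reach.split {v u : V} {n : ℕ} {P D : ℝ} (h : G.Reach v u n P) (hD : 0 ≤ D) :
    G.Reach v u n (min P D) ∨
      ∃ a b : V, ∃ k m : ℕ, ∃ P₁ w P₂ : ℝ, G.Reach v a k P₁ ∧ 0 ≤ w ∧
        G.wt a b ≤ ENNReal.ofReal w ∧ G.Reach b u m P₂ ∧ P₁ ≤ D ∧ D < P₁ + w ∧
        P₁ + w + P₂ = P := by
  induction h generalizing D with
  -- `P` is only an upper bound on the weight, so even the trivial walk may carry `P > D`; hence the
  -- minimum.
  | nil v hP => exact .inl (.nil v (le_min hP hD))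
  | @cons v x u n w P hw hwt h ih =>
    rcases lt_or_ge D w with hlt | hge
    · exact .inr ⟨v, x, 0, n, 0, w, P, .nil v le_rfl, hw, hwt, h, hD, by simpa using hlt,
        by ring⟩
    · rcases ih (D := D - w) (by linarith) with h1 | ⟨a, b, k, m, P₁, w', P₂, h1, h2, h3, h4, h5,
        h6, h7⟩
      · left
        refine (Reach.cons hw hwt h1).mono (le_min ?_ ?_)
        · linarith [min_le_left P (D - w)]
        · linarith [min_le_right P (D - w)]
      · exact .inr ⟨a, b, k + 1, m, w + P₁, w', P₂, .cons hw hwt h1, h2, h3, h4, by linarith,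
          by linarith, by linarith⟩

theorem reach_of_walkWeight_ne_top (p : List V) (v : V) (h : G.walkWeight v p ≠ ⊤) :
    G.Reach v (p.getLastD v) p.length (G.walkWeight v p).toReal := by
  induction p generalizing v with
  | nil => exact .nil v (by simp [walkWeight])
  | cons x p ih =>
    simp only [walkWeight, ne_eq, ENNReal.add_eq_top, not_or] at h
    rw [List.getLastD_cons, List.length_cons, walkWeight, ENNReal.toReal_add h.1 h.2]
    exact .cons ENNReal.toReal_nonneg (by rw [ENNReal.ofReal_toReal h.1]) (ih x h.2)

theorem Reach.exists_walk {v u : V} {n : ℕ} {P : ℝ} (h : G.Reach v u n P) :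
    ∃ p : List V, p.getLastD v = u ∧ p.length = n ∧ G.walkWeight v p ≤ ENNReal.ofReal P := by
  induction h with
  | nil v hP => exact ⟨[], rfl, rfl, by simp [walkWeight]⟩
  | @cons v x u n w P hw hwt h ih =>
    obtain ⟨p, h1, h2, h3⟩ := ih
    refine ⟨x :: p, by rw [List.getLastD_cons, h1], by simp [h2], ?_⟩
    rw [walkWeight, ENNReal.ofReal_add hw h.nonneg]
    exact add_le_add hwt h3

theorem Reach.dist_le {v u : V} {n : ℕ} {P : ℝ} (h : G.Reach v u n P) :
    G.dist v u ≤ ENNReal.ofReal P := by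
  obtain ⟨p, h1, -, h3⟩ := h.exists_walk
  exact (iInf₂_le p h1).trans h3

theorem Reach.hopDist_le {v u : V} {n h : ℕ} {P : ℝ} (hr : G.Reach v u n P) (hn : n ≤ h) :
    G.hopDist h v u ≤ ENNReal.ofReal P := by
  obtain ⟨p, h1, h2, h3⟩ := hr.exists_walk
  exact ((iInf₂_le p h1).trans (iInf_le _ (h2.trans_le hn))).trans h3

theorem dist_le_hopDist (h : ℕ) (v u : V) : G.dist v u ≤ G.hopDist h v u :=
  le_iInf₂ fun p hp => le_iInf fun _ => iInf₂_le p hp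

theorem exists_reach_of_dist_lt {v u : V} {P : ℝ} (h : G.dist v u < ENNReal.ofReal P) :
    ∃ n, G.Reach v u n P := by
  obtain ⟨p, hp⟩ := iInf_lt_iff.1 h
  obtain ⟨hpu, hp⟩ := iInf_lt_iff.1 hp
  subst hpu
  replace hp : G.walkWeight v p < ENNReal.ofReal P := by simpa using hp
  refine ⟨p.length, (reach_of_walkWeight_ne_top p v hp.ne_top).mono ?_⟩
  exact (ENNReal.toReal_mono ENNReal.ofReal_ne_top hp.le).trans_eq
    (ENNReal.toReal_ofReal (ENNReal.ofReal_pos.1 (pos_of_gt hp)).le)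

theorem le_dist {v u : V} {a : ℝ≥0∞}
    (h : ∀ n P, G.Reach v u n P → a ≤ ENNReal.ofReal P) : a ≤ G.dist v u := by
  refine le_iInf₂ fun p hp => ?_
  by_cases ht : G.walkWeight v p = ⊤
  · simp [ht]
  · subst hp
    simpa [ENNReal.ofReal_toReal ht] using h _ _ (reach_of_walkWeight_ne_top p v ht)

theorem dist_self (v : V) : G.dist v v = 0 := by
  simpa using (Reach.nil (G := G) v le_rfl).dist_le

theorem dist_comm (v u : V) : G.dist v u = G.dist u v :=
  le_antisymm (le_dist fun _ _ h => h.symm.dist_le) (le_dist fun _ _ h => h.symm.dist_le)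

theorem dist_triangle (v u x : V) : G.dist v x ≤ G.dist v u + G.dist u x := by
  refine ENNReal.le_of_forall_pos_le_add fun ε hε hlt => ?_
  obtain ⟨h1, h2⟩ := ENNReal.add_ne_top.1 hlt.ne
  have hε2 : (0 : ℝ) < ε / 2 := by positivity
  have key : ∀ a b : V, G.dist a b ≠ ⊤ → ∃ n, G.Reach a b n ((G.dist a b).toReal + ε / 2) := by
    intro a b h
    refine exists_reach_of_dist_lt ?_
    rw [ENNReal.lt_ofReal_iff_toReal_lt h]
    linarith
  obtain ⟨n, hn⟩ := key v u h1
  obtain ⟨m, hm⟩ := key u x h2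
  refine (hn.trans hm).dist_le.trans_eq ?_
  rw [show (G.dist v u).toReal + ε / 2 + ((G.dist u x).toReal + ε / 2) =
    (G.dist v u).toReal + (G.dist u x).toReal + ε by ring,
    ENNReal.ofReal_add (by positivity) (by positivity),
    ENNReal.ofReal_add (by positivity) (by positivity), ENNReal.ofReal_toReal h1,
    ENNReal.ofReal_toReal h2, ENNReal.ofReal_coe_nnreal]

theorem dist_le_wt (v u : V) : G.dist v u ≤ G.wt v u := by
  by_cases ht : G.wt v u = ⊤
  · simp [ht]
  · have h := (Reach.of_edge (G := G) (v := v) (u := u) (w := (G.wt v u).toReal)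
      ENNReal.toReal_nonneg (by rw [ENNReal.ofReal_toReal ht])).dist_le
    rwa [ENNReal.ofReal_toReal ht] at h

theorem one_le_dist (hG : ∀ a b, 1 ≤ G.wt a b) {v u : V} (h : v ≠ u) : 1 ≤ G.dist v u :=
  le_dist fun _ P hP => by simpa using ENNReal.ofReal_le_ofReal (hP.one_le hG h)

theorem walkWeight_mono (h : ∀ a b, G.wt a b ≤ H.wt a b) (v : V) (p : List V) :
    G.walkWeight v p ≤ H.walkWeight v p := by
  induction p generalizing v with
  | nil => exact le_rfl
  | cons x p ih => exact add_le_add (h v x) (ih x)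

theorem hopDist_mono (h : ∀ a b, G.wt a b ≤ H.wt a b) (n : ℕ) (v u : V) :
    G.hopDist n v u ≤ H.hopDist n v u :=
  iInf_mono fun p => iInf_mono fun _ => iInf_mono fun _ => walkWeight_mono h v p

/-- If no edge of `X` is shorter than the distance in `G`, then neither is any walk. -/
theorem dist_le_dist_of_dominated (h : ∀ a b, G.dist a b ≤ X.wt a b) (v u : V) :
    G.dist v u ≤ X.dist v u := by
  refine le_dist fun n P hP => ?_
  induction hP with
  | nil v hP => simp [dist_self]
  | @cons v x u n w P hw hwt hr ih =>
    rw [ENNReal.ofReal_add hw hr.nonneg]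
    exact (dist_triangle v x u).trans (add_le_add ((h v x).trans hwt) ih)

end WGraph

/-! ### Levels of monotone Even–Shiloach trees -/

theorem le_cap (D : ℕ) (a : ℕ∞) : a ≤ cap D a := by
  unfold cap
  split_ifs <;> simp

theorem cap_eq_self {D : ℕ} {a : ℕ∞} (h : a ≤ D) : cap D a = a := if_pos h

section Levels

variable {w : ℕ → V → V → ℕ∞} {D : ℕ} {S : Set V} {t : ℕ} {v : V}

theorem esUpdate_of_mem {w : V → V → ℕ∞} {prev : V → ℕ∞} (hv : v ∈ S) :
    esUpdate w S D prev v = 0 := by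
  unfold esUpdate
  rw [← OrderHom.map_lfp]
  exact if_pos hv

theorem esUpdate_of_notMem {w : V → V → ℕ∞} {prev : V → ℕ∞} (hv : v ∉ S) :
    esUpdate w S D prev v = cap D (max (prev v) (⨅ x, (esUpdate w S D prev x + w x v))) := by
  unfold esUpdate
  conv_lhs => rw [← OrderHom.map_lfp]
  exact if_neg hv

theorem esLevel_of_mem (hv : v ∈ S) : esLevel w D S t v = 0 := by
  cases t <;> exact esUpdate_of_mem hv

theorem esLevel_zero (hv : v ∉ S) :
    esLevel w D S 0 v = cap D (⨅ x, (esLevel w D S 0 x + w 0 x v)) := by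
  have h := esUpdate_of_notMem (w := w 0) (D := D) (prev := fun _ => 0) hv
  rwa [max_eq_right zero_le] at h

theorem esLevel_succ (hv : v ∉ S) :
    esLevel w D S (t + 1) v =
      cap D (max (esLevel w D S t v) (⨅ x, (esLevel w D S (t + 1) x + w (t + 1) x v))) :=
  esUpdate_of_notMem hv

theorem iInf_le_esLevel (hv : v ∉ S) :
    ⨅ x, (esLevel w D S t x + w t x v) ≤ esLevel w D S t v := by
  cases t with
  | zero =>
    conv_rhs => rw [esLevel_zero hv]
    exact le_cap _ _
  | succ t =>
    conv_rhs => rw [esLevel_succ hv]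
    exact (le_max_right _ _).trans (le_cap _ _)

theorem esLevel_le_succ (v : V) : esLevel w D S t v ≤ esLevel w D S (t + 1) v := by
  by_cases hv : v ∈ S
  · simp [esLevel_of_mem hv]
  · rw [esLevel_succ hv]
    exact (le_max_left _ _).trans (le_cap _ _)

/-- A vertex either keeps the level that it had before the update, or none of its edges is
stretched. -/
theorem esLevel_cases (hv : v ∉ S) :
    (∃ s, t = s + 1 ∧ (esLevel w D S s v ≤ D → esLevel w D S t v = esLevel w D S s v)) ∨
      ∀ x, esLevel w D S t x + w t x v ≤ D →
        esLevel w D S t v ≤ esLevel w D S t x + w t x v := by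
  cases t with
  | zero =>
    right
    intro x hx
    rw [esLevel_zero hv]
    have h := iInf_le (fun x => esLevel w D S 0 x + w 0 x v) x
    rwa [cap_eq_self (h.trans hx)]
  | succ t =>
    rcases le_total (⨅ x, (esLevel w D S (t + 1) x + w (t + 1) x v)) (esLevel w D S t v) with h | h
    · refine .inl ⟨t, rfl, fun hD => ?_⟩
      rw [esLevel_succ hv, max_eq_left h, cap_eq_self hD]
    · right
      intro x hx
      rw [esLevel_succ hv, max_eq_right h]
      have h := iInf_le (fun x => esLevel w D S (t + 1) x + w (t + 1) x v) x
      rwa [cap_eq_self (h.trans hx)]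

end Levels

/-! ### Roots in a tree -/

/-- Weights are at least `1`, so a parent has a strictly smaller level and the descent ends in a
root. Only the inequality `hL` is available, since monotone levels may exceed the minimum. -/
theorem exists_isRootOf [Finite V] {w : V → V → ℕ∞} {S : Set V} {L : V → ℕ∞}
    (hw : ∀ x v, 1 ≤ w x v) (hL : ∀ v, v ∉ S → ⨅ x, (L x + w x v) ≤ L v) (v : V)
    (hv : L v ≠ ⊤) : ∃ a, IsRootOf w S L v a := by
  obtain ⟨n, hn⟩ := ENat.ne_top_iff_exists.1 hv
  induction n using Nat.strong_induction_on generalizing v with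
  | _ n ih =>
    by_cases hS : v ∈ S
    · exact ⟨v, .root v hS⟩
    · have : Nonempty V := ⟨v⟩
      obtain ⟨x, hx⟩ := Finite.exists_min fun x => L x + w x v
      have hle : L x + w x v ≤ n := (le_iInf hx).trans ((hL v hS).trans_eq hn.symm)
      have hxt : L x ≠ ⊤ := by
        intro h
        simp [h] at hle
      obtain ⟨m, hm⟩ := ENat.ne_top_iff_exists.1 hxt
      have hmn : m < n := by
        have h : ((m + 1 : ℕ) : ℕ∞) ≤ n := by
          push_cast
          exact (add_le_add hm.le (hw x v)).trans hle
        exact_mod_cast h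
      obtain ⟨a, ha⟩ := ih m hmn x hxt hm
      exact ⟨a, .step v x a hS hx ha⟩

theorem IsRootOf.mem {w : V → V → ℕ∞} {S : Set V} {L : V → ℕ∞} {v a : V}
    (h : IsRootOf w S L v a) : a ∈ S := by
  induction h with
  | root a ha => exact ha
  | step v x a _ _ _ ih => exact ih

/-- The distance to the root is at most the unscaled level. -/
theorem IsRootOf.dist_le {w : V → V → ℕ∞} {S : Set V} {L : V → ℕ∞} {v a : V} {G : WGraph V}
    {η : ℝ≥0∞} (hw : ∀ x v, G.dist x v ≤ η * (w x v : ℝ≥0∞))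
    (hL : ∀ v, v ∉ S → ⨅ x, (L x + w x v) ≤ L v) (h : IsRootOf w S L v a) :
    G.dist v a ≤ η * (L v : ℝ≥0∞) := by
  induction h with
  | root a ha => simp [WGraph.dist_self]
  | step v x a hv hmin _ ih =>
    calc G.dist v a ≤ G.dist v x + G.dist x a := WGraph.dist_triangle v x a
      _ ≤ η * (w x v : ℝ≥0∞) + η * (L x : ℝ≥0∞) :=
        add_le_add ((WGraph.dist_comm v x).trans_le (hw x v)) ih
      _ = η * ((L x + w x v : ℕ∞) : ℝ≥0∞) := by rw [ENat.toENNReal_add, mul_add, add_comm]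
      _ ≤ η * (L v : ℝ≥0∞) := by
        gcongr
        exact (le_iInf hmin).trans (hL v hv)

/-! ### Scaled weights -/

section Scaled

variable {η : ℝ}

theorem le_mul_ceil (hη : 0 < η) (a : ℝ≥0∞) :
    a ≤ ENNReal.ofReal η * (ENat.ceil (a / ENNReal.ofReal η) : ℝ≥0∞) := by
  rw [mul_comm, ← ENNReal.div_le_iff (by simpa using hη) ENNReal.ofReal_ne_top]
  exact ENat.le_ceil_self

theorem mul_ceil_le (hη : 0 < η) {a : ℝ≥0∞} {x : ℝ} (hx : 0 ≤ x) (ha : a ≤ ENNReal.ofReal x) :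
    ENNReal.ofReal η * (ENat.ceil (a / ENNReal.ofReal η) : ℝ≥0∞) ≤ ENNReal.ofReal (x + η) := by
  have h0 : ENNReal.ofReal η ≠ 0 := by simpa using hη
  have hlt : a / ENNReal.ofReal η ≠ ⊤ :=
    (ENNReal.div_lt_top (ha.trans_lt ENNReal.ofReal_lt_top).ne h0).ne
  calc _ ≤ ENNReal.ofReal η * (a / ENNReal.ofReal η + 1) := by
        gcongr
        exact (ENat.ceil_lt_add_one hlt).le
    _ = a + ENNReal.ofReal η := by
        rw [mul_add, mul_one, ENNReal.mul_div_cancel h0 ENNReal.ofReal_ne_top]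
    _ ≤ _ := by
        rw [ENNReal.ofReal_add hx hη.le]
        gcongr

theorem one_le_ceil {a : ℝ≥0∞} (ha : a ≠ 0) :
    1 ≤ ENat.ceil (a / ENNReal.ofReal η) := by
  rw [Order.one_le_iff_pos, ENat.ceil_pos]
  exact ENNReal.div_pos ha ENNReal.ofReal_ne_top

/-- This is what keeps levels from being truncated: a real bound below `η * D` shows that the cap is
inactive. -/
theorem level_le_depth (hη : 0 < η) {D : ℕ} {a : ℕ∞} {b : ℝ} (hb : b ≤ η * D)
    (h : ENNReal.ofReal η * (a : ℝ≥0∞) ≤ ENNReal.ofReal b) : a ≤ D := by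
  have h0 : ENNReal.ofReal η ≠ 0 := by simpa using hη
  have h1 := h.trans (ENNReal.ofReal_le_ofReal hb)
  rw [ENNReal.ofReal_mul hη.le, ENNReal.mul_le_mul_iff_right h0 ENNReal.ofReal_ne_top,
    ENNReal.ofReal_natCast] at h1
  exact_mod_cast h1

end Scaled

/-! ### Levels in scaled graphs -/

section ScaledLevels

variable {X : ℕ → WGraph V} {R ε₀ : ℝ} {l D : ℕ} {S : Set V}

theorem dist_le_mul_scale (hη : 0 < unit R ε₀ l) {G Y : WGraph V}
    (hY : ∀ a b, G.dist a b ≤ Y.wt a b) (a b : V) :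
    G.dist a b ≤ ENNReal.ofReal (unit R ε₀ l) * (scale Y R ε₀ l a b : ℝ≥0∞) :=
  (hY a b).trans (le_mul_ceil hη _)

theorem one_le_scale {G Y : WGraph V} (hG : ∀ a b, 1 ≤ G.wt a b)
    (hY : ∀ a b, G.dist a b ≤ Y.wt a b) (a b : V) : 1 ≤ scale Y R ε₀ l a b := by
  refine one_le_ceil ?_
  rcases eq_or_ne a b with rfl | h
  · simp [Y.loopless]
  · exact (zero_lt_one.trans_le ((WGraph.one_le_dist hG h).trans (hY a b))).ne'

theorem scaled_level_add_le (hη : 0 < unit R ε₀ l) {Y : WGraph V} {L : ℕ∞} {v x : V} {w b : ℝ}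
    (hw : 0 ≤ w) (hb : 0 ≤ b) (hwt : Y.wt v x ≤ ENNReal.ofReal w)
    (hL : ENNReal.ofReal (unit R ε₀ l) * (L : ℝ≥0∞) ≤ ENNReal.ofReal b) :
    ENNReal.ofReal (unit R ε₀ l) * ((L + scale Y R ε₀ l x v : ℕ∞) : ℝ≥0∞) ≤
      ENNReal.ofReal (b + w + unit R ε₀ l) := by
  rw [ENat.toENNReal_add, mul_add, add_assoc, ENNReal.ofReal_add hb (by positivity)]
  exact add_le_add hL (mul_ceil_le hη hw (by rwa [Y.symm]))

/-- A vertex either keeps its unscaled level or has no stretched edges. -/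
theorem scaled_esLevel_cases (hη : 0 < unit R ε₀ l) {t : ℕ} {v : V} (hv : v ∉ S) :
    (∃ s, t = s + 1 ∧ ∀ b, b ≤ unit R ε₀ l * D →
      ENNReal.ofReal (unit R ε₀ l) *
        (esLevel (fun t => scale (X t) R ε₀ l) D S s v : ℝ≥0∞) ≤ ENNReal.ofReal b →
      ENNReal.ofReal (unit R ε₀ l) *
        (esLevel (fun t => scale (X t) R ε₀ l) D S t v : ℝ≥0∞) ≤ ENNReal.ofReal b) ∨
    ∀ x w b, 0 ≤ w → 0 ≤ b → (X t).wt v x ≤ ENNReal.ofReal w →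
      ENNReal.ofReal (unit R ε₀ l) *
        (esLevel (fun t => scale (X t) R ε₀ l) D S t x : ℝ≥0∞) ≤ ENNReal.ofReal b →
      b + w + unit R ε₀ l ≤ unit R ε₀ l * D →
      ENNReal.ofReal (unit R ε₀ l) *
        (esLevel (fun t => scale (X t) R ε₀ l) D S t v : ℝ≥0∞) ≤
          ENNReal.ofReal (b + w + unit R ε₀ l) := by
  rcases esLevel_cases (w := fun t => scale (X t) R ε₀ l) (D := D) (t := t) hv with
    ⟨s, hs, h⟩ | h
  · refine .inl ⟨s, hs, fun b hb hle => ?_⟩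
    rwa [h (level_le_depth hη hb hle)]
  · right
    intro x w b hw hb hwt hL hD
    have hadd := scaled_level_add_le hη hw hb hwt hL
    refine le_trans ?_ hadd
    gcongr
    exact h x (level_le_depth hη hD hadd)

/-- Edges whose weight never decreases are never stretched. -/
theorem scaled_esLevel_le_of_edge (hη : 0 < unit R ε₀ l) {G : ℕ → WGraph V}
    (hdec : ∀ t u v, (G t).wt u v ≤ (G (t + 1)).wt u v)
    (hX : ∀ t u v, (X t).wt u v ≤ (G t).wt u v) {t : ℕ} {v x : V} {w b : ℝ}
    (hw : 0 ≤ w) (hb : 0 ≤ b) (hwt : (G t).wt v x ≤ ENNReal.ofReal w)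
    (hL : ENNReal.ofReal (unit R ε₀ l) *
      (esLevel (fun t => scale (X t) R ε₀ l) D S t x : ℝ≥0∞) ≤ ENNReal.ofReal b)
    (hD : b + w + unit R ε₀ l ≤ unit R ε₀ l * D) :
    ENNReal.ofReal (unit R ε₀ l) *
      (esLevel (fun t => scale (X t) R ε₀ l) D S t v : ℝ≥0∞) ≤
        ENNReal.ofReal (b + w + unit R ε₀ l) := by
  by_cases hv : v ∈ S
  · simp [esLevel_of_mem hv]
  · induction t with
    | zero =>
      rcases scaled_esLevel_cases (X := X) (D := D) (t := 0) hη hv with ⟨s, hs, -⟩ | h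
      · simp at hs
      · exact h x w b hw hb ((hX _ _ _).trans hwt) hL hD
    | succ t ih =>
      rcases scaled_esLevel_cases (X := X) (D := D) (t := t + 1) hη hv with ⟨s, hs, h⟩ | h
      · obtain rfl : t = s := by simpa using hs
        -- Before the update both the edge and the level of `x` were no larger, so the retained
        -- level already obeyed the bound.
        refine h _ hD (ih ((hdec _ _ _).trans hwt) (le_trans ?_ hL))
        gcongr
        exact esLevel_le_succ x
      · exact h x w b hw hb ((hX _ _ _).trans hwt) hL hD

end ScaledLevels

/-! ### Distance bounds by potentials -/

theorem exists_rank {A : ℕ → Set V} {K m : ℕ} (hA : Antitone A) (hK : A K = ∅) {z : V}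
    (hz : z ∈ A m) : ∃ i, m ≤ i ∧ i < K ∧ z ∈ A i ∧ z ∉ A (i + 1) := by
  have hlt : ∀ i, z ∈ A i → i < K := by
    intro i hi
    by_contra h
    have := hA (not_lt.1 h) hi
    simp [hK] at this
  by_contra! h
  have hall : ∀ n, z ∈ A (m + n) := by
    intro n
    induction n with
    | zero => exact hz
    | succ n ih => exact h _ (Nat.le_add_right _ _) (hlt _ ih) ih
  exact absurd (hlt _ (hall K)) (by omega)

/-- Let `Bd v b` say that a vertex `v` has been connected to `S` at cost `b`, where each edge causes
the additional cost `η`. If a vertex of rank `i` is joined to all vertices of distance at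
most `D i` or to a near vertex of higher rank, then costs exceed distances by a factor `α` and an
offset `γ i` at most. -/
theorem bound_of_jumps {G X : WGraph V} {A : ℕ → Set V} {K : ℕ} (hA_zero : A 0 = Set.univ)
    (hA : Antitone A) (hK : A K = ∅) {σ α η M : ℝ} {γ D : ℕ → ℝ} (hη : 0 < η) (hσ : 1 ≤ σ)
    (hσα : σ ≤ α) (hα : α ≤ 5 / 4) (hγ_anti : Antitone γ) (hγ : ∀ i < K, η ≤ γ i)
    (hD_nonneg : ∀ i < K, 0 ≤ D i)
    (hD : ∀ i < K, γ 0 - γ i + 2 * η ≤ (α - σ) * D i)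
    (hstep : ∀ i, i + 1 < K → 9 / 4 * (9 / 2 * D i) + η ≤ γ i - γ (i + 1))
    {S : Set V} {Bd : V → ℝ → Prop} (hmono : ∀ v b b', b ≤ b' → Bd v b → Bd v b')
    (hroot : ∀ s ∈ S, Bd s 0)
    (hedge : ∀ v x w b, 0 ≤ w → 0 ≤ b → G.wt v x ≤ ENNReal.ofReal w → Bd x b → b + w + η ≤ M →
      Bd v (b + w + η))
    (hcases : ∀ v, v ∉ S →
      (∀ i < K, v ∈ A i → v ∉ A (i + 1) → ∀ s ∈ S, ∀ n P, G.Reach v s n P → α * P + γ i ≤ M →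
        Bd v (α * P + γ i)) ∨
      ∀ x w b, 0 ≤ w → 0 ≤ b → X.wt v x ≤ ENNReal.ofReal w → Bd x b → b + w + η ≤ M →
        Bd v (b + w + η))
    (hjump : ∀ i < K, ∀ v u n P, v ∈ A i → v ∉ A (i + 1) → v ≠ u → G.Reach v u n P → P ≤ D i →
      X.wt v u ≤ ENNReal.ofReal (σ * P) ∨
      ∃ z ∈ A (i + 1), ∃ m, G.Reach v z m (9 / 2 * P) ∧ X.wt v z ≤ ENNReal.ofReal (9 / 2 * P))
    {i : ℕ} (hi : i < K) {v s : V} (hv : v ∈ A i) (hv' : v ∉ A (i + 1)) (hs : s ∈ S) {n : ℕ} {P : ℝ}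
    (hP : G.Reach v s n P) (hM : α * P + γ i ≤ M) : Bd v (α * P + γ i) := by
  -- Each recursive call lowers the bound `α * P + γ i` by at least `η`, so its quotient by `η`
  -- limits the depth of the recursion.
  obtain ⟨N, hN⟩ := exists_nat_gt ((α * P + γ i) / η)
  rw [div_lt_iff₀ hη] at hN
  induction N generalizing i v n P with
  | zero =>
    have := hγ i hi
    have := mul_nonneg (by linarith : 0 ≤ α) hP.nonneg
    norm_num at hN
    linarith
  | succ N ih =>
    push_cast at hN
    have hP0 := hP.nonneg
    have hγi := hγ i hi
    have hαP : 0 ≤ α * P := mul_nonneg (by linarith) hP0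
    have hDi := hD_nonneg i hi
    by_cases hvS : v ∈ S
    · exact hmono v _ _ (by linarith) (hroot v hvS)
    rcases hcases v hvS with h | hX'
    · exact h i hi hv hv' s hs n P hP hM
    -- From `z` the walk returns through `v`. The edge costs `9 / 2 * Q` and the return at most `5 /
    -- 4` times that, which explains the factor `9 / 4` in `hstep`.
    have hpivot : ∀ z ∈ A (i + 1), ∀ m Q, Q ≤ D i → G.Reach v z m (9 / 2 * Q) →
        X.wt v z ≤ ENNReal.ofReal (9 / 2 * Q) → Bd v (α * P + γ i) := by
      intro z hz m Q hQ hr hwt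
      obtain ⟨i', hii', hi', hzi, hzi'⟩ := exists_rank hA hK hz
      have hQ0 := hr.nonneg
      have hst := hstep i (by omega)
      have hγ' := hγ_anti hii'
      have hαQ : α * (9 / 2 * Q) ≤ 5 / 4 * (9 / 2 * Q) := mul_le_mul_of_nonneg_right hα hQ0
      have hαQ0 : 0 ≤ α * (9 / 2 * Q) := mul_nonneg (by linarith) hQ0
      have hexp : α * (9 / 2 * Q + P) = α * (9 / 2 * Q) + α * P := by ring
      have hb := ih hi' hzi hzi' (hr.symm.trans hP) (by linarith) (by linarith)
      have hγi' := hγ i' hi'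
      exact hmono v _ _ (by linarith) (hX' z _ _ hQ0 (by linarith) hwt hb (by linarith))
    rcases hP.split hDi with hall | ⟨a, b, k, m, P₁, w, P₂, h1, hw, hwt, h2, hP1, hP1w, hsum⟩
    · have hne : v ≠ s := fun h => hvS (h ▸ hs)
      rcases hjump i hi v s n _ hv hv' hne hall (min_le_right _ _) with hc | ⟨z, hz, m, hr, hwt⟩
      · have hmin : σ * min P (D i) ≤ α * P :=
          mul_le_mul hσα (min_le_left _ _) hall.nonneg (by linarith)
        have hmin0 : 0 ≤ σ * min P (D i) := mul_nonneg (by linarith) hall.nonneg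
        exact hmono v _ _ (by linarith) (hX' s _ 0 hmin0 le_rfl hc (hroot s hs) (by linarith))
      · exact hpivot z hz m _ (min_le_right _ _) hr hwt
    · obtain ⟨ib, -, hib, hb, hb'⟩ := exists_rank hA hK (by simp [hA_zero] : b ∈ A 0)
      have hP10 := h1.nonneg
      have hP20 := h2.nonneg
      -- The rank of `b` may be lower than `i`, so its offset is only bounded by `γ 0`. The gain `(α
      -- - σ) * D i` pays for this reset and for the charges of the two edges to `a` and to `b`.
      have hD' := hD i hi
      have hγb : γ ib ≤ γ 0 := hγ_anti (Nat.zero_le _)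
      have hγb0 := hγ ib hib
      have e1 : (α - σ) * D i ≤ (α - σ) * (P₁ + w) :=
        mul_le_mul_of_nonneg_left hP1w.le (by linarith)
      have e2 : (σ - 1) * w ≥ 0 := mul_nonneg (by linarith) hw
      have e3 : α * P = α * P₁ + α * w + α * P₂ := by rw [← hsum]; ring
      have e4 : (α - σ) * (P₁ + w) = α * P₁ + α * w - σ * P₁ - σ * w := by ring
      have e5 : (σ - 1) * w = σ * w - w := by ring
      have e6 : 0 ≤ σ * P₁ := mul_nonneg (by linarith) hP10
      have e7 : 0 ≤ α * P₂ := mul_nonneg (by linarith) hP20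
      have hbd := ih hib hb hb' h2 (by linarith) (by linarith)
      rcases eq_or_ne v a with rfl | hne
      · exact hmono v _ _ (by linarith)
          (hedge v b w _ hw (by linarith) hwt hbd (by linarith))
      · rcases hjump i hi v a k P₁ hv hv' hne h1 hP1 with hc | ⟨z, hz, m', hr, hwt'⟩
        -- Nothing is known about stretched hopset edges at `a`; the step to `b` is safe because it
        -- is an edge of `G`.
        · have hba := hedge a b w _ hw (by linarith) hwt hbd (by linarith)
          exact hmono v _ _ (by linarith) (hX' a _ _ e6 (by linarith) hc hba (by linarith))
        · exact hpivot z hz m' P₁ hP1 hr hwt'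

/-- Offsets and jump lengths that are suitable for `bound_of_jumps` at the scale `T`. -/
theorem exists_offsets {ε η T : ℝ} {K β : ℕ} (hε : 0 < ε) (hε_le : ε ≤ 1 / 6) (hη : 0 < η)
    (hK : 1 ≤ K) (hβ : (24 * K / ε) ^ K ≤ β) (hT : η * (2 * β + 1) ≤ 3 / 2 * T) :
    ∃ γ D : ℕ → ℝ, Antitone γ ∧ (∀ i < K, η ≤ γ i) ∧ γ 0 ≤ ε * T / 10 ∧
      (∀ i < K, 0 ≤ D i) ∧ (∀ i < K, D i ≤ T / 5) ∧
      (∀ i < K, γ 0 - γ i + 2 * η ≤ ε / 2 * D i) ∧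
      ∀ i, i + 1 < K → 9 / 4 * (9 / 2 * D i) + η ≤ γ i - γ (i + 1) := by
  obtain ⟨k, rfl⟩ : ∃ k, K = k + 1 := ⟨K - 1, by omega⟩
  -- With `D i = 4 / 23 * η * q ^ (i + 1)`, a pivot detour costs `81 / 8 * D i`, which is below
  -- `1.77 * η * q ^ (i + 1)`. The drop of `γ` is `2 * η * (q ^ (i + 1) - q ^ i)`, and `q ≥ 138`
  -- absorbs the rest.
  set q : ℝ := 23 / ε with hq
  have hq1 : 1 ≤ q := by rw [hq, le_div_iff₀ hε]; linarith
  have hqε : q * ε = 23 := div_mul_cancel₀ _ hε.ne'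
  have hqmono : ∀ {a b : ℕ}, a ≤ b → q ^ a ≤ q ^ b := fun h => pow_le_pow_right₀ hq1 h
  have hqβ : 15 * q ^ k ≤ ε * β := by
    have hk1 : (1 : ℝ) ≤ ((k + 1 : ℕ) : ℝ) := by exact_mod_cast Nat.le_add_left 1 k
    have h1 : q ≤ 24 * (k + 1 : ℕ) / ε := by
      rw [hq]
      gcongr
      linarith
    have h2 : 15 * q ^ k ≤ ε * (24 * (k + 1 : ℕ) / ε) ^ (k + 1) := by
      have e : ε * (24 * (k + 1 : ℕ) / ε) ^ (k + 1) =
          24 * (k + 1 : ℕ) * (24 * (k + 1 : ℕ) / ε) ^ k := by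
        rw [pow_succ]
        field_simp
      rw [e]
      exact mul_le_mul (by linarith) (pow_le_pow_left₀ (by linarith) h1 k) (by positivity)
        (by positivity)
    exact h2.trans (by gcongr)
  have hqk : η * q ^ k ≤ ε * T / 20 := by
    have h1 : η * (15 * q ^ k) ≤ η * (ε * β) := by gcongr
    have h2 : ε * (η * (2 * β + 1)) ≤ ε * (3 / 2 * T) := by gcongr
    nlinarith [mul_pos hη hε]
  -- Chosen so that `γ 0 - γ i + 2 * η = ε / 2 * D i` holds with equality and the last offset is `2
  -- * η`.
  refine ⟨fun i => 2 * η * q ^ k + 2 * η - 2 * η * q ^ i, fun i => 4 * η * q ^ i / ε, ?_, ?_, ?_,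
    ?_, ?_, ?_, ?_⟩
  · intro a b hab
    have := mul_le_mul_of_nonneg_left (hqmono hab) hη.le
    dsimp only
    linarith
  · intro i hi
    have := mul_le_mul_of_nonneg_left (hqmono (by omega : i ≤ k)) hη.le
    dsimp only
    linarith
  · simp only [pow_zero]
    linarith
  · intro i _
    positivity
  · intro i hi
    have := mul_le_mul_of_nonneg_left (hqmono (by omega : i ≤ k)) hη.le
    rw [div_le_iff₀ hε]
    linarith
  · intro i _
    have : ε / 2 * (4 * η * q ^ i / ε) = 2 * η * q ^ i := by field_simp; ring
    rw [this]
    simp only [pow_zero]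
    linarith
  · intro i _
    have e : 4 * η * q ^ i / ε = 4 / 23 * (η * q ^ (i + 1)) := by
      rw [div_eq_iff hε.ne', pow_succ]
      linear_combination (-(4 / 23) * η * q ^ i) * hqε
    have h1 : η ≤ η * q ^ i := le_mul_of_one_le_right hη.le (one_le_pow₀ hq1)
    have h2 : 138 * (η * q ^ i) ≤ η * q ^ (i + 1) := by
      have : 138 ≤ q := by rw [hq, le_div_iff₀ hε]; linarith
      rw [pow_succ]
      nlinarith
    dsimp only
    rw [e]
    linarith

namespace Config

/-! ### The graphs of the hopset algorithm -/

/-- The graph `G ∪ H̄_j` over time. -/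
noncomputable def augmented (c : Config V) (G : ℕ → WGraph V) (j t : ℕ) : WGraph V :=
  (G t).union (c.Hbar G j t)

/-- The distance estimates over the scales below `j`. -/
noncomputable def estimate (c : Config V) (G : ℕ → WGraph V) (j t : ℕ) : V → V → ℝ≥0∞ :=
  (c.run G j).2 t

/-- The assumptions on the dynamic graph and on the parameters of the hopset algorithm. -/
structure Valid (c : Config V) (G : ℕ → WGraph V) (K : ℕ) : Prop where
  one_le : ∀ t u v, 1 ≤ (G t).wt u v
  dec : ∀ t u v, (G t).wt u v ≤ (G (t + 1)).wt u v
  A_zero : c.A 0 = Set.univ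
  A_anti : Antitone c.A
  A_K : c.A K = ∅
  pick_mem : ∀ t j u (S : Set V), S.Nonempty → c.pick t j u S ∈ S
  κ_le : c.κ ≤ 1
  ε_pos : 0 < c.ε₂
  ε_le : c.ε₂ ≤ 1 / 6
  K_pos : 1 ≤ K
  le_β : (24 * K / c.ε₂) ^ K ≤ c.β

variable {c : Config V} {G : ℕ → WGraph V} {K : ℕ}

theorem Hbar_succ (j t : ℕ) : c.Hbar G (j + 1) t = (c.Hbar G j t).union
    (c.newEdges j (c.augmented G j) (c.estimate G (j + 1) t) t) := rfl

theorem estimate_succ (j t : ℕ) (z v : V) : c.estimate G (j + 1) t z v =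
    min (c.estimate G j t z v)
      (ENNReal.ofReal (c.eta j) * (c.level j (c.augmented G j) t {z} v : ℝ≥0∞)) := rfl

theorem eta_mul (j : ℕ) : c.eta j * (2 * c.β + 1) = c.ε₂ * 2 ^ j := by
  have : (2 * (c.β : ℝ) + 1) ≠ 0 := by positivity
  unfold eta unit
  push_cast
  exact div_mul_cancel₀ _ this

theorem eta_pos (hε : 0 < c.ε₂) (j : ℕ) : 0 < c.eta j := by
  unfold eta unit
  positivity

theorem le_eta_mul_depth (hε : 0 < c.ε₂) (j : ℕ) : 2 * 2 ^ j ≤ c.eta j * c.depth := by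
  have h1 : 2 * (2 * (c.β : ℝ) + 1) / c.ε₂ ≤ c.depth := Nat.le_ceil _
  refine le_trans (le_of_eq ?_) (mul_le_mul_of_nonneg_left h1 (eta_pos hε j).le)
  rw [← mul_div_assoc, eq_div_iff hε.ne']
  linear_combination -2 * eta_mul (c := c) j

theorem augmented_wt_le (j t : ℕ) (u v : V) : (c.augmented G j t).wt u v ≤ (G t).wt u v :=
  min_le_left _ _

theorem Hbar_wt_anti (t : ℕ) (u v : V) : Antitone fun j => (c.Hbar G j t).wt u v :=
  antitone_nat_of_succ_le fun _ => min_le_left _ _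

theorem augmented_wt_anti (t : ℕ) (u v : V) : Antitone fun j => (c.augmented G j t).wt u v :=
  fun _ _ h => min_le_min le_rfl (Hbar_wt_anti t u v h)

theorem augmented_le_hopEdge {r j : ℕ} (h : r < j) (t : ℕ) {u v : V} (huv : u ≠ v) :
    (c.augmented G j t).wt u v ≤
      c.hopEdge r (c.augmented G r) (c.estimate G (r + 1) t) t u v := by
  refine (augmented_wt_anti t u v h).trans ((min_le_right _ _).trans ?_)
  rw [Hbar_succ]
  exact (min_le_right _ _).trans ((iInf_le _ huv).trans (min_le_left _ _))

theorem augmented_le_of_inCluster {r j : ℕ} (h : r < j) {t : ℕ} {u v : V} (huv : u ≠ v)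
    (hc : c.InCluster r (c.augmented G r) t u v) :
    (c.augmented G j t).wt u v ≤
      ENNReal.ofReal (c.eta r) * (c.level r (c.augmented G r) t {u} v : ℝ≥0∞) := by
  refine (augmented_le_hopEdge h t huv).trans ((min_le_left _ _).trans ((iInf_le _ hc).trans ?_))
  rw [estimate_succ]
  exact min_le_right _ _

theorem augmented_le_of_pivot {r j : ℕ} (h : r < j) {t i : ℕ} {z : V} (hz : z ∈ c.A i)
    (hz' : z ∉ c.A (i + 1)) (hne : z ≠ c.pivot r (c.augmented G r) t i z) :
    (c.augmented G j t).wt z (c.pivot r (c.augmented G r) t i z) ≤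
      ENNReal.ofReal (c.eta r) * (c.level r (c.augmented G r) t (c.A (i + 1)) z : ℝ≥0∞) :=
  (augmented_le_hopEdge h t hne).trans
    ((min_le_right _ _).trans (iInf₂_le_of_le i ⟨hz, hz', rfl⟩ le_rfl))

/-! ### Hopset edges do not undercut distances -/

section Lower

variable {j t : ℕ} {X : ℕ → WGraph V} {S : Set V}

theorem exists_isRootOf_level [Finite V] (hG : ∀ t u v, 1 ≤ (G t).wt u v)
    (hX : ∀ t u v, (G t).dist u v ≤ (X t).wt u v) {v : V} (hv : c.level j X t S v ≠ ⊤) :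
    ∃ a, IsRootOf (c.scaled j X t) S (c.level j X t S) v a :=
  exists_isRootOf (w := c.scaled j X t) (one_le_scale (hG t) (hX t))
    (fun _ h => iInf_le_esLevel h) v hv

theorem dist_le_level (hε : 0 < c.ε₂) (hX : ∀ t u v, (G t).dist u v ≤ (X t).wt u v) {v a : V}
    (h : IsRootOf (c.scaled j X t) S (c.level j X t S) v a) :
    (G t).dist v a ≤ ENNReal.ofReal (c.eta j) * (c.level j X t S v : ℝ≥0∞) :=
  h.dist_le (dist_le_mul_scale (eta_pos hε j) (hX t)) fun _ h => iInf_le_esLevel h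

theorem exists_root_dist_le [Finite V] (hε : 0 < c.ε₂) (hG : ∀ t u v, 1 ≤ (G t).wt u v)
    (hX : ∀ t u v, (G t).dist u v ≤ (X t).wt u v) {v : V}
    (hv : ENNReal.ofReal (c.eta j) * (c.level j X t S v : ℝ≥0∞) ≠ ⊤) :
    ∃ a ∈ S, IsRootOf (c.scaled j X t) S (c.level j X t S) v a ∧
      (G t).dist v a ≤ ENNReal.ofReal (c.eta j) * (c.level j X t S v : ℝ≥0∞) := by
  have hv' : c.level j X t S v ≠ ⊤ := by
    intro h
    simp [h, ENNReal.mul_top, eta_pos hε j] at hv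
  obtain ⟨a, ha⟩ := exists_isRootOf_level hG hX hv'
  exact ⟨a, ha.mem, ha, dist_le_level hε hX ha⟩

theorem isRootOf_pivot [Finite V] (hε : 0 < c.ε₂) (hG : ∀ t u v, 1 ≤ (G t).wt u v)
    (hpick : ∀ t j u (S : Set V), S.Nonempty → c.pick t j u S ∈ S)
    (hX : ∀ t u v, (G t).dist u v ≤ (X t).wt u v) {i : ℕ} {v : V}
    (hv : ENNReal.ofReal (c.eta j) * (c.level j X t (c.A (i + 1)) v : ℝ≥0∞) ≠ ⊤) :
    IsRootOf (c.scaled j X t) (c.A (i + 1)) (c.level j X t (c.A (i + 1))) v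
      (c.pivot j X t i v) := by
  obtain ⟨a, -, ha, -⟩ := exists_root_dist_le hε hG hX hv
  exact hpick t j v {a | IsRootOf _ _ _ v a} ⟨a, ha⟩

theorem dist_le_hopEdge [Finite V] (hε : 0 < c.ε₂) (hG : ∀ t u v, 1 ≤ (G t).wt u v)
    (hpick : ∀ t j u (S : Set V), S.Nonempty → c.pick t j u S ∈ S)
    (hX : ∀ t u v, (G t).dist u v ≤ (X t).wt u v) {est : V → V → ℝ≥0∞}
    (hest : ∀ u v, (G t).dist u v ≤ est u v) (u v : V) :
    (G t).dist u v ≤ c.hopEdge j X est t u v := by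
  refine le_min (le_iInf fun _ => hest u v) (le_iInf₂ fun i hi => ?_)
  obtain ⟨-, -, rfl⟩ := hi
  by_cases ht : ENNReal.ofReal (c.eta j) * (c.level j X t (c.A (i + 1)) u : ℝ≥0∞) = ⊤
  · simp [ht]
  · exact dist_le_level hε hX (isRootOf_pivot hε hG hpick hX ht)

theorem dist_le_newEdges [Finite V] (hε : 0 < c.ε₂) (hG : ∀ t u v, 1 ≤ (G t).wt u v)
    (hpick : ∀ t j u (S : Set V), S.Nonempty → c.pick t j u S ∈ S)
    (hX : ∀ t u v, (G t).dist u v ≤ (X t).wt u v) {est : V → V → ℝ≥0∞}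
    (hest : ∀ u v, (G t).dist u v ≤ est u v) (u v : V) :
    (G t).dist u v ≤ (c.newEdges j X est t).wt u v := by
  refine le_iInf fun _ => le_min (dist_le_hopEdge hε hG hpick hX hest u v) ?_
  rw [WGraph.dist_comm]
  exact dist_le_hopEdge hε hG hpick hX hest v u

/-- The two bounds need a joint induction: the estimates of the next scale come from trees on the
graph augmented so far, and the new edges use these estimates. -/
theorem dist_le_Hbar_and_estimate [Finite V] (hc : c.Valid G K) (j : ℕ) :
    (∀ t u v, (G t).dist u v ≤ (c.Hbar G j t).wt u v) ∧
      ∀ t u v, (G t).dist u v ≤ c.estimate G j t u v := by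
  induction j with
  | zero => exact ⟨fun _ _ _ => le_top, fun _ _ _ => le_top⟩
  | succ j ih =>
    have hX : ∀ t u v, (G t).dist u v ≤ (c.augmented G j t).wt u v :=
      fun t u v => le_min (WGraph.dist_le_wt u v) (ih.1 t u v)
    have hest : ∀ t u v, (G t).dist u v ≤ c.estimate G (j + 1) t u v := by
      intro t u v
      rw [estimate_succ]
      refine le_min (ih.2 t u v) ?_
      by_cases ht : ENNReal.ofReal (c.eta j) *
          (c.level j (c.augmented G j) t {u} v : ℝ≥0∞) = ⊤
      · simp [ht]
      · obtain ⟨a, rfl, -, ha⟩ := exists_root_dist_le hc.ε_pos hc.one_le hX ht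
        rwa [WGraph.dist_comm]
    refine ⟨fun t u v => ?_, hest⟩
    rw [Hbar_succ]
    exact le_min (ih.1 t u v)
      (dist_le_newEdges hc.ε_pos hc.one_le hc.pick_mem hX (hest t) u v)

theorem dist_le_augmented [Finite V] (hc : c.Valid G K) (j t : ℕ) (u v : V) :
    (G t).dist u v ≤ (c.augmented G j t).wt u v :=
  le_min (WGraph.dist_le_wt u v) ((dist_le_Hbar_and_estimate hc j).1 t u v)

end Lower

/-! ### Levels and distances -/

/-- The intervals from `3 / 4 * 2 ^ r` to `3 / 2 * 2 ^ r` cover all lengths from `3 / 4` on. -/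
theorem exists_scale {P : ℝ} {j : ℕ} (hP : 1 ≤ P) (hPj : P < 3 / 4 * 2 ^ j) :
    ∃ r < j, 3 / 4 * 2 ^ r ≤ P ∧ P ≤ 3 / 2 * 2 ^ r := by
  obtain ⟨r, h1, h2⟩ := exists_nat_pow_near (x := 4 / 3 * P) (y := (2 : ℝ)) (by linarith)
    one_lt_two
  refine ⟨r, ?_, by linarith, ?_⟩
  · exact (pow_lt_pow_iff_right₀ (one_lt_two (α := ℝ))).1 (by linarith)
  · rw [pow_succ] at h2
    linarith

/-- At the scale `r` fitting `P`, either `u` lies in the cluster of `v`, or the cluster condition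
fails. As `κ ≤ 1`, failure puts a vertex of `A (i + 1)` near `u`, hence near `v`, and the pivot of
`v` at a second fitting scale is then close. -/
theorem exists_jump [Finite V] (hc : c.Valid G K) {j t : ℕ} {σ : ℝ}
    (hσ : σ ≤ 7 / 6)
    (hlevel : ∀ r < j, ∀ (S : Set V) (v s : V) (n : ℕ) (P : ℝ), s ∈ S → (G t).Reach v s n P →
      3 / 4 * 2 ^ r ≤ P → P ≤ 3 / 2 * 2 ^ r →
        ENNReal.ofReal (c.eta r) * (c.level r (c.augmented G r) t S v : ℝ≥0∞) ≤
          ENNReal.ofReal (σ * P))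
    {i n : ℕ} {v u : V} {P : ℝ} (hv : v ∈ c.A i) (hv' : v ∉ c.A (i + 1)) (hne : v ≠ u)
    (hP : (G t).Reach v u n P) (hPj : P ≤ 2 ^ j / 5) :
    (c.augmented G j t).wt v u ≤ ENNReal.ofReal (σ * P) ∨
      ∃ z ∈ c.A (i + 1), ∃ m, (G t).Reach v z m (9 / 2 * P) ∧
        (c.augmented G j t).wt v z ≤ ENNReal.ofReal (9 / 2 * P) := by
  have h2j : (0 : ℝ) < 2 ^ j := by positivity
  have hP1 : 1 ≤ P := hP.one_le (hc.one_le t) hne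
  have hP0 : 0 < P := by linarith
  obtain ⟨r, hrj, hr1, hr2⟩ := exists_scale hP1 (by linarith : P < 3 / 4 * 2 ^ j)
  have hL := hlevel r hrj {v} u v n P rfl hP.symm hr1 hr2
  by_cases hcl : c.InCluster r (c.augmented G r) t v u
  · exact .inl ((augmented_le_of_inCluster hrj hne hcl).trans hL)
  right
  have hcl' : (c.level r (c.augmented G r) t (c.A (i + 1)) u : ℝ≥0∞) ≤
      ENNReal.ofReal (1 + c.κ) * (c.level r (c.augmented G r) t {v} u : ℝ≥0∞) :=
    not_lt.1 fun h => hcl ⟨i, hv, hv', h⟩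
  have hLA : ENNReal.ofReal (c.eta r) *
      (c.level r (c.augmented G r) t (c.A (i + 1)) u : ℝ≥0∞) ≤ ENNReal.ofReal (7 / 3 * P) :=
    calc _ ≤ ENNReal.ofReal (c.eta r) * (ENNReal.ofReal (1 + c.κ) *
          (c.level r (c.augmented G r) t {v} u : ℝ≥0∞)) := by gcongr
      _ = ENNReal.ofReal (1 + c.κ) * (ENNReal.ofReal (c.eta r) *
          (c.level r (c.augmented G r) t {v} u : ℝ≥0∞)) := by ring
      _ ≤ ENNReal.ofReal 2 * ENNReal.ofReal (σ * P) := by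
        gcongr
        linarith [hc.κ_le]
      _ = ENNReal.ofReal (2 * (σ * P)) := (ENNReal.ofReal_mul zero_le_two).symm
      _ ≤ _ := ENNReal.ofReal_le_ofReal (by nlinarith)
  obtain ⟨a, haA, -, ha⟩ := exists_root_dist_le hc.ε_pos hc.one_le (dist_le_augmented hc r)
    (hLA.trans_lt ENNReal.ofReal_lt_top).ne
  obtain ⟨m, hm⟩ := WGraph.exists_reach_of_dist_lt (P := 5 / 2 * P)
    ((ha.trans hLA).trans_lt ((ENNReal.ofReal_lt_ofReal_iff (by linarith)).2 (by linarith)))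
  have hva := hP.trans hm
  -- `7 / 2 * (2 ^ j / 5)` is below `3 / 4 * 2 ^ j`, so this scale is also smaller than `j`. The
  -- level bound is `7 / 6 * 7 / 2 = 49 / 12`; the slack up to `9 / 2` gives an actual walk.
  obtain ⟨r', hrj', hr1', hr2'⟩ := exists_scale (P := P + 5 / 2 * P) (j := j) (by linarith)
    (by linarith)
  have hL' : ENNReal.ofReal (c.eta r') *
      (c.level r' (c.augmented G r') t (c.A (i + 1)) v : ℝ≥0∞) ≤
        ENNReal.ofReal (49 / 12 * P) :=
    (hlevel r' hrj' _ v a _ _ haA hva hr1' hr2').trans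
      (ENNReal.ofReal_le_ofReal (by nlinarith))
  have hroot := isRootOf_pivot hc.ε_pos hc.one_le hc.pick_mem (dist_le_augmented hc r')
    (hL'.trans_lt ENNReal.ofReal_lt_top).ne
  have hlt : ENNReal.ofReal (49 / 12 * P) < ENNReal.ofReal (9 / 2 * P) :=
    (ENNReal.ofReal_lt_ofReal_iff (by linarith)).2 (by linarith)
  obtain ⟨m', hm'⟩ := WGraph.exists_reach_of_dist_lt
    (((dist_le_level hc.ε_pos (dist_le_augmented hc r') hroot).trans hL').trans_lt hlt)
  refine ⟨_, hroot.mem, m', hm', (augmented_le_of_pivot hrj' hv hv' ?_).trans (hL'.trans hlt.le)⟩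
  intro h
  exact hv' (h ▸ hroot.mem)

theorem reach_of_reach_succ (hc : c.Valid G K) {t n : ℕ} {v s : V} {P : ℝ}
    (h : (G (t + 1)).Reach v s n P) : (G t).Reach v s n P :=
  h.of_graph_le (hc.dec t)

/-- Unscaled levels of scale `j` approximate distances of about `2 ^ j`. -/
theorem level_le [Finite V] (hc : c.Valid G K) (j : ℕ) (hj : j * c.ε₂ ≤ 1 / 6) (t : ℕ) (S : Set V)
    (v s : V) (n : ℕ) (P : ℝ) (hs : s ∈ S) (hP : (G t).Reach v s n P) (hP1 : 3 / 4 * 2 ^ j ≤ P)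
    (hP2 : P ≤ 3 / 2 * 2 ^ j) :
    ENNReal.ofReal (c.eta j) * (c.level j (c.augmented G j) t S v : ℝ≥0∞) ≤
      ENNReal.ofReal ((1 + (j + 1) * c.ε₂) * P) := by
  induction j using Nat.strong_induction_on generalizing t S v s n P with
  | _ j ih =>
    have hε := hc.ε_pos
    have hε6 := hc.ε_le
    have hjε : 0 ≤ j * c.ε₂ := by positivity
    have h2j : (0 : ℝ) < 2 ^ j := by positivity
    have hηpos := eta_pos hε j
    obtain ⟨γ, D, hγ_anti, hγ, hγ0, hD0, hDT, hD, hstep⟩ := exists_offsets (T := 2 ^ j) hε hε6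
      hηpos hc.K_pos hc.le_β (by rw [eta_mul]; nlinarith)
    have hM := le_eta_mul_depth hε j
    have hjump : ∀ t, ∀ i < K, ∀ v u n P, v ∈ c.A i → v ∉ c.A (i + 1) → v ≠ u →
        (G t).Reach v u n P → P ≤ D i →
          (c.augmented G j t).wt v u ≤ ENNReal.ofReal ((1 + j * c.ε₂) * P) ∨
          ∃ z ∈ c.A (i + 1), ∃ m, (G t).Reach v z m (9 / 2 * P) ∧
            (c.augmented G j t).wt v z ≤ ENNReal.ofReal (9 / 2 * P) := by
      intro t i hi v u n P hv hv' hne hr hPD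
      refine exists_jump hc (by linarith) ?_ hv hv' hne hr (hPD.trans (hDT i hi))
      intro r hr S v s n P hs hR h1 h2
      have hrj : ((r : ℝ) + 1) ≤ j := by exact_mod_cast hr
      have hrε : ((r : ℝ) + 1) * c.ε₂ ≤ j * c.ε₂ := by gcongr
      refine (ih r hr (by linarith) t S v s n P hs hR h1 h2).trans
        (ENNReal.ofReal_le_ofReal ?_)
      have := hR.nonneg
      gcongr
    -- The induction on time must keep the rank-dependent offset: a retained level is compared with
    -- the old bound for the same rank.
    have key : ∀ t, ∀ i < K, ∀ v, v ∈ c.A i → v ∉ c.A (i + 1) → ∀ s ∈ S, ∀ n P,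
        (G t).Reach v s n P → (1 + j * c.ε₂ + c.ε₂ / 2) * P + γ i ≤ c.eta j * c.depth →
        ENNReal.ofReal (c.eta j) * (c.level j (c.augmented G j) t S v : ℝ≥0∞) ≤
          ENNReal.ofReal ((1 + j * c.ε₂ + c.ε₂ / 2) * P + γ i) := by
      intro t
      induction t with
      | zero =>
        intro i hi v hv hv' s hs n P hP hPM
        refine bound_of_jumps (G := G 0) (X := c.augmented G j 0) hc.A_zero hc.A_anti hc.A_K
          (σ := 1 + j * c.ε₂) (D := D) hηpos (by linarith) (by linarith) (by linarith)
          hγ_anti hγ hD0 (fun i hi => (hD i hi).trans_eq (by ring)) hstep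
          (Bd := fun v b => ENNReal.ofReal (c.eta j) *
            (c.level j (c.augmented G j) 0 S v : ℝ≥0∞) ≤ ENNReal.ofReal b)
          (fun v b b' hb h => h.trans (ENNReal.ofReal_le_ofReal hb))
          (fun s hs => by simp [level, esLevel_of_mem hs])
          (fun v x w b hw hb hwt hB hbM => scaled_esLevel_le_of_edge hηpos hc.dec
            (fun t => augmented_wt_le j t) hw hb hwt hB hbM)
          (fun v hvS => ?_) (hjump 0) hi hv hv' hs hP hPM
        rcases scaled_esLevel_cases (X := c.augmented G j) (D := c.depth) (t := 0) hηpos hvS with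
          ⟨s, hs, -⟩ | h
        · simp at hs
        · exact .inr h
      | succ t iht =>
        intro i hi v hv hv' s hs n P hP hPM
        refine bound_of_jumps (G := G (t + 1)) (X := c.augmented G j (t + 1)) hc.A_zero hc.A_anti
          hc.A_K (σ := 1 + j * c.ε₂) (D := D) hηpos (by linarith) (by linarith) (by linarith)
          hγ_anti hγ hD0 (fun i hi => (hD i hi).trans_eq (by ring)) hstep
          (Bd := fun v b => ENNReal.ofReal (c.eta j) *
            (c.level j (c.augmented G j) (t + 1) S v : ℝ≥0∞) ≤ ENNReal.ofReal b)
          (fun v b b' hb h => h.trans (ENNReal.ofReal_le_ofReal hb))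
          (fun s hs => by simp [level, esLevel_of_mem hs])
          (fun v x w b hw hb hwt hB hbM => scaled_esLevel_le_of_edge hηpos hc.dec
            (fun t => augmented_wt_le j t) hw hb hwt hB hbM)
          (fun v hvS => ?_) (hjump (t + 1)) hi hv hv' hs hP hPM
        rcases scaled_esLevel_cases (X := c.augmented G j) (D := c.depth) (t := t + 1) hηpos hvS
          with ⟨s, hs, h⟩ | h
        · obtain rfl : t = s := by simpa using hs
          exact .inl fun i hi hv hv' s hs n P hP hPM =>
            h _ hPM (iht i hi v hv hv' s hs n P (reach_of_reach_succ hc hP) hPM)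
        · exact .inr h
    obtain ⟨i, -, hi, hv, hv'⟩ := exists_rank hc.A_anti hc.A_K (by simp [hc.A_zero] : v ∈ c.A 0)
    have hγi : γ i ≤ γ 0 := hγ_anti (Nat.zero_le i)
    have hα : (1 + j * c.ε₂ + c.ε₂ / 2) * P ≤ 5 / 4 * P :=
      mul_le_mul_of_nonneg_right (by linarith) hP.nonneg
    have hεT : c.ε₂ * 2 ^ j ≤ 1 / 6 * 2 ^ j := by gcongr
    -- The bound is at most `(5 / 4 * 3 / 2 + 1 / 60) * 2 ^ j`, within the tree depth of `2 * 2 ^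
    -- j`.
    refine (key t i hi v hv hv' s hs n P hP (by linarith)).trans
      (ENNReal.ofReal_le_ofReal ?_)
    -- Since `P` is at least `3 / 4 * 2 ^ j`, the offset fits into the remaining stretch `c.ε₂ / 2 *
    -- P`.
    have hεP : c.ε₂ * (3 / 4 * 2 ^ j) ≤ c.ε₂ * P := by gcongr
    have hε2 : 0 < c.ε₂ * 2 ^ j := by positivity
    linarith

/-! ### Hop-limited walks and the hopset property -/

/-- Walks of the given graph are replaced by walks with few edges. -/
theorem exists_reach_augmented [Finite V] (hc : c.Valid G K) {j : ℕ} (hj : j * c.ε₂ ≤ 1 / 6)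
    {η : ℝ} (hη : 0 < η) (hηj : η * (2 * c.β + 1) ≤ 3 / 2 * 2 ^ j) {t n : ℕ} {x y : V} {P : ℝ}
    (hP : (G t).Reach x y n P) :
    ∃ m w, (c.augmented G j t).Reach x y m w ∧
      w + η * m ≤ (1 + j * c.ε₂ + c.ε₂ / 2) * P + c.ε₂ * 2 ^ j / 10 := by
  have hε := hc.ε_pos
  have hε6 := hc.ε_le
  have hjε : 0 ≤ j * c.ε₂ := by positivity
  obtain ⟨γ, D, hγ_anti, hγ, hγ0, hD0, hDT, hD, hstep⟩ := exists_offsets (T := 2 ^ j) hε hε6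
    hη hc.K_pos hc.le_β hηj
  obtain ⟨i, -, hi, hv, hv'⟩ := exists_rank hc.A_anti hc.A_K (by simp [hc.A_zero] : x ∈ c.A 0)
  have hedge : ∀ v x w b, 0 ≤ w → 0 ≤ b → (c.augmented G j t).wt v x ≤ ENNReal.ofReal w →
      (∃ m w, (c.augmented G j t).Reach x y m w ∧ w + η * m ≤ b) →
      b + w + η ≤ (1 + j * c.ε₂ + c.ε₂ / 2) * P + γ i →
      ∃ m w', (c.augmented G j t).Reach v y m w' ∧ w' + η * m ≤ b + w + η := by
    rintro v x w b hw - hwt ⟨m, w', hr, hle⟩ -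
    refine ⟨m + 1, w + w', .cons hw hwt hr, ?_⟩
    push_cast
    linarith
  obtain ⟨m, w, hr, hle⟩ := bound_of_jumps (G := G t) (X := c.augmented G j t) hc.A_zero hc.A_anti
    hc.A_K (σ := 1 + j * c.ε₂) (D := D) hη (by linarith) (by linarith) (by linarith) hγ_anti hγ
    hD0 (fun i hi => (hD i hi).trans_eq (by ring)) hstep (S := {y})
    (Bd := fun v b => ∃ m w, (c.augmented G j t).Reach v y m w ∧ w + η * m ≤ b)
    (fun v b b' hb ⟨m, w, h1, h2⟩ => ⟨m, w, h1, h2.trans hb⟩)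
    (fun s hs => ⟨0, 0, by obtain rfl := hs; exact .nil _ le_rfl, by simp⟩)
    (fun v x w b hw hb hwt => hedge v x w b hw hb ((augmented_wt_le j t v x).trans hwt))
    -- Static walks have no history, so no edge is ever stretched here.
    (fun v _ => .inr (hedge v)) (fun i hi v u n P hv hv' hne hr hPD => by
      refine exists_jump hc (by linarith) ?_ hv hv' hne hr (hPD.trans (hDT i hi))
      intro r hr S v s n P hs hR h1 h2
      have hrj : ((r : ℝ) + 1) ≤ j := by exact_mod_cast hr
      have hrε : ((r : ℝ) + 1) * c.ε₂ ≤ j * c.ε₂ := by gcongr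
      refine (level_le hc r (by linarith) t S v s n P hs hR h1 h2).trans
        (ENNReal.ofReal_le_ofReal ?_)
      have := hR.nonneg
      gcongr) hi hv hv' rfl hP le_rfl
  have hγi : γ i ≤ γ 0 := hγ_anti (Nat.zero_le i)
  exact ⟨m, w, hr, by linarith⟩

theorem dist_le_dist_augmented [Finite V] (hc : c.Valid G K) (j t : ℕ) (x y : V) :
    (G t).dist x y ≤ (c.augmented G j t).dist x y :=
  WGraph.dist_le_dist_of_dominated (dist_le_augmented hc j t) x y

theorem two_le_β (hc : c.Valid G K) : 2 ≤ c.β := by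
  have hK : (1 : ℝ) ≤ K := by exact_mod_cast hc.K_pos
  have h1 : 2 ≤ 24 * K / c.ε₂ := by
    rw [le_div_iff₀ hc.ε_pos]
    linarith [hc.ε_le]
  have h2 : (2 : ℝ) ≤ c.β :=
    h1.trans ((le_self_pow₀ (by linarith) (by have := hc.K_pos; omega)).trans hc.le_β)
  exact_mod_cast h2

/-- Weights are at least `1`, so a walk lighter than `3` has at most two edges and needs no
shortcut. -/
theorem hopDist_zero_le (hc : c.Valid G K) {t : ℕ} {x y : V} (hd : (G t).dist x y ≤ 2) :
    (c.augmented G 0 t).hopDist c.β x y ≤ (G t).dist x y := by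
  refine WGraph.le_dist fun n P hP => ?_
  rcases lt_or_ge P 3 with h3 | h3
  · refine (hP.of_graph_le (augmented_wt_le 0 t)).hopDist_le (le_trans ?_ (two_le_β hc))
    have : (n : ℝ) < 3 := (hP.length_le (hc.one_le t)).trans_lt h3
    have : n < 3 := by exact_mod_cast this
    omega
  · have hlt : (G t).dist x y < ENNReal.ofReal (5 / 2) := by
      refine hd.trans_lt ?_
      rw [← ENNReal.ofReal_ofNat, ENNReal.ofReal_lt_ofReal_iff (by norm_num)]
      norm_num
    obtain ⟨m, hm⟩ := WGraph.exists_reach_of_dist_lt hlt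
    have h5 : (m : ℝ) ≤ 5 / 2 := hm.length_le (hc.one_le t)
    have hm3 : m < 3 := by
      have : (m : ℝ) < 3 := by linarith
      exact_mod_cast this
    refine ((hm.mono (by linarith)).of_graph_le (augmented_wt_le 0 t)).hopDist_le
      (le_trans ?_ (two_le_β hc))
    omega

theorem hopDist_augmented_le [Finite V] (hc : c.Valid G K) {j : ℕ} (hj : j * c.ε₂ ≤ 1 / 6) {t : ℕ}
    {x y : V} (hd1 : 2 ^ j ≤ (G t).dist x y) (hd2 : (G t).dist x y ≤ 2 ^ (j + 1)) :
    (c.augmented G j t).hopDist c.β x y ≤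
      ENNReal.ofReal ((1 + 3 * c.ε₂) ^ j) * (G t).dist x y := by
  rcases Nat.eq_zero_or_pos j with rfl | hj0
  · simpa using hopDist_zero_le hc (by simpa using hd2)
  have hε := hc.ε_pos
  have hε6 := hc.ε_le
  have hj1 : (1 : ℝ) ≤ j := by exact_mod_cast hj0
  have h2j : (0 : ℝ) < 2 ^ j := by positivity
  have htop : (G t).dist x y ≠ ⊤ := (hd2.trans_lt (by simp)).ne
  obtain ⟨d, hd0, hd⟩ : ∃ d : ℝ, 0 ≤ d ∧ (G t).dist x y = ENNReal.ofReal d :=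
    ⟨_, ENNReal.toReal_nonneg, (ENNReal.ofReal_toReal htop).symm⟩
  have hpow : ∀ k : ℕ, (2 : ℝ≥0∞) ^ k = ENNReal.ofReal (2 ^ k) := by
    intro k
    rw [ENNReal.ofReal_pow zero_le_two, ENNReal.ofReal_ofNat]
  rw [hd, hpow] at hd1 hd2
  rw [ENNReal.ofReal_le_ofReal_iff hd0] at hd1
  rw [ENNReal.ofReal_le_ofReal_iff (by positivity), pow_succ] at hd2
  have hdpos : 0 < d := h2j.trans_le hd1
  obtain ⟨n, hn⟩ := WGraph.exists_reach_of_dist_lt (G := G t) (v := x) (u := y)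
    (P := d * (1 + c.ε₂ / 10)) (by
      rw [hd, ENNReal.ofReal_lt_ofReal_iff (by positivity)]
      nlinarith)
  -- The largest hop price that `exists_offsets` permits when `j * c.ε₂ = 1 / 6`. The excess cost is
  -- at most `4 * (j * c.ε₂) * 2 ^ j`, so `9 * m ≤ 4 * (2 * c.β + 1)`, which forces `m ≤ c.β`.
  -- Positivity needs `j ≥ 1`.
  set η : ℝ := 9 * (j * c.ε₂) * 2 ^ j / (2 * c.β + 1) with hη
  have hℓ : (0 : ℝ) < 2 * c.β + 1 := by positivity
  have hηℓ : η * (2 * c.β + 1) = 9 * (j * c.ε₂) * 2 ^ j := div_mul_cancel₀ _ hℓ.ne'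
  obtain ⟨m, w, hr, hle⟩ := exists_reach_augmented hc hj (η := η) (by positivity)
    (by rw [hηℓ]; nlinarith) hn
  have hη0 : 0 < η := by positivity
  have hdw : d ≤ w := by
    have h := (dist_le_dist_augmented hc j t x y).trans hr.dist_le
    rwa [hd, ENNReal.ofReal_le_ofReal_iff hr.nonneg] at h
  have hcost : w + η * m ≤ (1 + 2 * (j * c.ε₂)) * d := by
    refine hle.trans ?_
    have h1 : c.ε₂ * 2 ^ j ≤ c.ε₂ * d := by gcongr
    have h2 : c.ε₂ * d ≤ j * c.ε₂ * d := by
      gcongr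
      exact le_mul_of_one_le_left hε.le hj1
    have h3 : (1 + j * c.ε₂ + c.ε₂ / 2) * (d * (1 + c.ε₂ / 10)) ≤
        (1 + j * c.ε₂ + c.ε₂ / 2) * d + 5 / 4 * (d * (c.ε₂ / 10)) := by
      have : (1 + j * c.ε₂ + c.ε₂ / 2) * (d * (c.ε₂ / 10)) ≤ 5 / 4 * (d * (c.ε₂ / 10)) := by
        gcongr
        linarith
      linarith
    have h4 : 0 < c.ε₂ * d := by positivity
    linarith
  have hw : w ≤ (1 + 3 * c.ε₂) ^ j * d := by
    have h1 : 1 + j * (3 * c.ε₂) ≤ (1 + 3 * c.ε₂) ^ j :=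
      one_add_mul_le_pow (by linarith) j
    have h2 : (1 + 2 * (j * c.ε₂)) * d ≤ (1 + 3 * c.ε₂) ^ j * d := by
      gcongr
      have : 0 ≤ j * c.ε₂ := by positivity
      linarith
    have : 0 ≤ η * m := by positivity
    linarith
  have hm : m ≤ c.β := by
    have h1 : η * m ≤ 4 * (j * c.ε₂) * 2 ^ j := by
      have : (j * c.ε₂) * d ≤ (j * c.ε₂) * (2 ^ j * 2) := by gcongr
      linarith
    have h2 : (j * c.ε₂ * 2 ^ j) * (9 * m) ≤ (j * c.ε₂ * 2 ^ j) * (4 * (2 * c.β + 1)) := by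
      calc _ = η * (2 * c.β + 1) * m := by rw [hηℓ]; ring
        _ = η * m * (2 * c.β + 1) := by ring
        _ ≤ 4 * (j * c.ε₂) * 2 ^ j * (2 * c.β + 1) := by gcongr
        _ = _ := by ring
    have h3 : (9 : ℝ) * m ≤ 4 * (2 * c.β + 1) := le_of_mul_le_mul_left h2 (by positivity)
    have h4 : 9 * m ≤ 4 * (2 * c.β + 1) := by exact_mod_cast h3
    omega
  rw [hd, ← ENNReal.ofReal_mul (by positivity)]
  exact (hr.hopDist_le hm).trans (ENNReal.ofReal_le_ofReal hw)

theorem isHopset_Hbar [Finite V] (hc : c.Valid G K) {W ε : ℝ} (hW : 0 < W) (hε_pos : 0 < ε)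
    (hε_le : ε ≤ 1)
    (hε : c.ε₂ * (6 * Real.logb 2 W) ≤ ε) {t J : ℕ}
    (hdist : ∀ x y, (G t).dist x y ≠ ⊤ → (G t).dist x y ≤ ENNReal.ofReal W)
    (hJ : W < 2 ^ (J + 1)) : IsHopset (G t) (c.Hbar G J t) ⊤ c.β ε := by
  intro u v _
  refine ⟨(dist_le_dist_augmented hc J t u v).trans (WGraph.dist_le_hopDist _ _ _), ?_⟩
  change (c.augmented G J t).hopDist c.β u v ≤ _
  rcases eq_or_ne u v with rfl | hne
  · exact ((WGraph.Reach.nil u le_rfl).hopDist_le (Nat.zero_le _)).trans (by simp)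
  have hεpos := hc.ε_pos
  by_cases htop : (G t).dist u v = ⊤
  · rw [htop, ENNReal.mul_top (by simpa using by linarith)]
    exact le_top
  obtain ⟨d, hd0, hd⟩ : ∃ d : ℝ, 0 ≤ d ∧ (G t).dist u v = ENNReal.ofReal d :=
    ⟨_, ENNReal.toReal_nonneg, (ENNReal.ofReal_toReal htop).symm⟩
  have hpow : ∀ k : ℕ, (2 : ℝ≥0∞) ^ k = ENNReal.ofReal (2 ^ k) := by
    intro k
    rw [ENNReal.ofReal_pow zero_le_two, ENNReal.ofReal_ofNat]
  have hd1 : 1 ≤ d := by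
    have h := WGraph.one_le_dist (hc.one_le t) hne
    rwa [hd, ENNReal.one_le_ofReal] at h
  have hdW : d ≤ W := by
    have h := hdist u v htop
    rwa [hd, ENNReal.ofReal_le_ofReal_iff hW.le] at h
  obtain ⟨j, hj1, hj2⟩ := exists_nat_pow_near hd1 (one_lt_two (α := ℝ))
  have hjJ : j ≤ J := by
    have : j < J + 1 := (pow_lt_pow_iff_right₀ (one_lt_two (α := ℝ))).1 (by linarith)
    omega
  have hjW : (j : ℝ) ≤ Real.logb 2 W := by
    rw [Real.le_logb_iff_rpow_le one_lt_two hW, Real.rpow_natCast]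
    linarith
  have hjε : j * c.ε₂ ≤ ε / 6 := by
    have : c.ε₂ * j ≤ c.ε₂ * Real.logb 2 W := by gcongr
    linarith
  have hhop := hopDist_augmented_le hc (by linarith : j * c.ε₂ ≤ 1 / 6) (t := t) (x := u) (y := v)
    (by rw [hd, hpow]; exact ENNReal.ofReal_le_ofReal hj1)
    (by rw [hd, hpow]; exact ENNReal.ofReal_le_ofReal hj2.le)
  -- The power is at most `exp (ε / 2)`, hence at most `1 + ε / 2 + ε ^ 2 / 4`.
  have hpow_le : (1 + 3 * c.ε₂) ^ j ≤ 1 + ε := by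
    have h1 : (1 + 3 * c.ε₂) ^ j ≤ Real.exp (3 * c.ε₂) ^ j :=
      pow_le_pow_left₀ (by linarith) (by linarith [Real.add_one_le_exp (3 * c.ε₂)]) j
    have h2 : Real.exp (3 * c.ε₂) ^ j ≤ Real.exp (ε / 2) := by
      rw [← Real.exp_nat_mul]
      exact Real.exp_le_exp.2 (by linarith)
    have h3 := (abs_le.1 (Real.abs_exp_sub_one_sub_id_le (x := ε / 2)
      (by rw [abs_le]; constructor <;> linarith))).2
    nlinarith
  exact (WGraph.hopDist_mono (fun a b => augmented_wt_anti t a b hjJ) _ u v).trans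
    (hhop.trans (by gcongr))

end Config

end DecHopset

theorem mainTheorem8 {V : Type*} [Fintype V]
    -- the weighted graph after `t` updates; updates are deletions and weight increases
    (G : ℕ → DecHopset.WGraph V)
    (hG : ∀ t u v, 1 ≤ (G t).wt u v)
    (hdec : ∀ t u v, (G t).wt u v ≤ (G (t + 1)).wt u v)
    -- the sampled sets
    (K : ℕ) (A : ℕ → Set V) (hA_zero : A 0 = Set.univ) (hA_anti : Antitone A) (hA_K : A K = ∅)
    -- the tie-breaking rule for pivots
    (pick : ℕ → ℕ → V → Set V → V)
    (hpick : ∀ t j u (S : Set V), S.Nonempty → pick t j u S ∈ S)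
    -- the parameters
    (κ ε ε' δ W : ℝ) (β : ℕ)
    (hκ_nonneg : 0 ≤ κ) (hκ_le : κ ≤ 1) (hε : 0 < ε) (hε_lt : ε < 1) (hW : 2 ≤ W)
    (hε'_pos : 0 < ε') (hε'_le : ε' ≤ ε / (6 * Real.logb 2 W))
    (hδ : δ = ε' / (8 * K)) (hβ : β = ⌈(3 / δ) ^ K⌉₊)
    (c : DecHopset.Config V)
    (hc : c = { A := A, κ := κ, ε₂ := ε', β := β, pick := pick }) :
    (∀ (t j : ℕ) (x y : V), (j : ℝ) ≤ Real.logb 2 W →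
      2 ^ j ≤ (G t).dist x y → (G t).dist x y ≤ 2 ^ (j + 1) →
        (G t).dist x y ≤ ((G t).union (c.Hbar G j t)).dist x y ∧
        ((G t).union (c.Hbar G j t)).dist x y ≤ ((G t).union (c.Hbar G j t)).hopDist β x y ∧
        ((G t).union (c.Hbar G j t)).hopDist β x y ≤
          ENNReal.ofReal ((1 + 3 * ε') ^ j) * (G t).dist x y) ∧
    (∀ t J : ℕ, (∀ x y, (G t).dist x y ≠ ⊤ → (G t).dist x y ≤ ENNReal.ofReal W) →
      W < 2 ^ (J + 1) →
        DecHopset.IsHopset (G t) (c.Hbar G J t) ⊤ β ε) := by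
  -- Without vertices `K = 0` would be possible; otherwise `A 0 ≠ ∅` gives `K ≥ 1`.
  rcases isEmpty_or_nonempty V with hV | hV
  · exact ⟨fun _ _ x => hV.elim x, fun _ _ _ _ x => hV.elim x⟩
  have hK : 1 ≤ K := by
    rw [Nat.one_le_iff_ne_zero]
    rintro rfl
    rw [hA_zero] at hA_K
    exact Set.empty_ne_univ hA_K.symm
  have hlog : 1 ≤ Real.logb 2 W := by
    rw [Real.le_logb_iff_rpow_le one_lt_two (by linarith), Real.rpow_one]
    exact hW
  have hεlog : ε' * (6 * Real.logb 2 W) ≤ ε := by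
    rwa [le_div_iff₀ (by linarith)] at hε'_le
  have hvalid : c.Valid G K := by
    subst hc
    refine ⟨hG, hdec, hA_zero, hA_anti, hA_K, hpick, hκ_le, hε'_pos, ?_, hK, ?_⟩
    · show ε' ≤ 1 / 6
      nlinarith
    · have hK0 : (K : ℝ) ≠ 0 := by positivity
      have h3δ : 3 / δ = 24 * K / ε' := by
        rw [hδ]
        field_simp
        norm_num
      show (24 * K / ε') ^ K ≤ (β : ℝ)
      rw [hβ, ← h3δ]
      exact Nat.le_ceil _
  obtain rfl : c.ε₂ = ε' := by rw [hc]
  obtain rfl : c.β = β := by rw [hc]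
  refine ⟨fun t j x y hj h1 h2 => ⟨DecHopset.Config.dist_le_dist_augmented hvalid j t x y,
    DecHopset.WGraph.dist_le_hopDist _ _ _,
    DecHopset.Config.hopDist_augmented_le hvalid ?_ h1 h2⟩, fun t J hdist hJ =>
    DecHopset.Config.isHopset_Hbar hvalid (by linarith) hε hε_lt.le hεlog hdist hJ⟩
  have : c.ε₂ * j ≤ c.ε₂ * Real.logb 2 W := by gcongr
  linarith
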